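/- **Definitions.** Let $K$ be a finite field with $m$ elements, let $d\le m$, and identify $1,\dots,d$ with $d$ distinct elements of $K$. For $e\ge 0$ let $$\mathsf{NW}_{d,m,e}=\sum_{p\in K[t],\ \deg p<e}x_{1,p(1)}\cdots x_{d,p(d)},$$ a polynomial in the $n=md$ variables $x_{i,a}$ ($1\le i\le d$, $a\in K$), with coefficients in a field $F$. For a polynomial $P$ in $n$ variables over $F$, $\Gamma^{\mathrm{PSD}}_{k,\ell}(P)$ is the dimension of the span of all $\mathrm{mult}(x^\beta\,\partial_{x^\alpha}P)$ with $\deg x^\alpha=k$ and $\deg x^\beta=\ell$, where $\mathrm{mult}(f)$ keeps only the multilinear monomials of $f$. For $c\in F^n$, $C_{k,\ell}(P)$ is the matrix with rows indexed by pairs $(\partial_{x^\alpha},x^\beta)$ with $\deg x^\alpha=k$, $\deg x^\beta=\ell$, and columns indexed by the multilinear monomials of degree at most $\ell+d-k$; its entries are the coefficients of these monomials in the multilinearization of $x^\beta\,\partial_{x^\alpha}P$ with respect to $c+\{0,1\}^n$ (the unique multilinear polynomial that agrees with it on $c+\{0,1\}^n$). $C'_{k,\ell}(P)$ is the submatrix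 with the rows where $x^\beta$ is multilinear and the columns of degree exactly $\ell+d-k$. For positive constants $c_1,c_2,c_3,c_4,A$, say that $d,k,m,e,\varepsilon$ satisfy the constraints if $c_1d^2\le m\le c_2d^2$, $c_3\frac{\log d}{\sqrt d}\le\varepsilon\le c_4\frac{\log d}{\sqrt d}$, and $$m^k\ \ge\ (1+\varepsilon)^{2(d-k)},\qquad \Bigl(\tfrac{2}{1+\varepsilon}\Bigr)^{d-k}m^{-A}\ \le\ m^{e-k}\ \le\ \Bigl(\tfrac{2}{1+\varepsilon}\Bigr)^{d-k}m^{A}.$$ **Lemma.** 1. For all $a,b>0$ there are positive constants $c_1,c_2,c_3,c_4,A$ such that for every $d\ge1$ and every integer $k\le d$ with $a\sqrt d\le k\le b\sqrt d$ there are a prime power $m\ge d$, an integer $e$ with $k\le e\le m$, and a real $\varepsilon<1$ that satisfy the constraints. 2. For all positive constants $b,c_1,c_2,c_3,c_4,A$ there are $B>0$ and $d_0$ such that the following holds for every $d\ge d_0$, every $k\le b\sqrt d$, all $m,e,\varepsilon$ satisfying the constraints such that $m$ is the cardinality of a finite field $K$, every choice of $d$ distinct points of $K$, and every integer $\ell\ge0$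 with $|\ell-\frac n2(1-\varepsilon)|<1$, where $n=md$. Over any field $F$, $$\Gamma^{\mathrm{PSD}}_{k,\ell}(\mathsf{NW}_{d,m,e})\ \ge\ \binom{n}{\ell+d-k}\exp(-B\log^2 d),$$ and for every $c\in F^n$, $$\mathrm{rank}\,C_{k,\ell}(\mathsf{NW}_{d,m,e})\ \ge\ \mathrm{rank}\,C'_{k,\ell}(\mathsf{NW}_{d,m,e})\ \ge\ \binom{n}{\ell+d-k}\exp(-B\log^2 d).$$ -/

import Mathlib

/-- There are finitely many univariate polynomials of degree less than `e` over a finite field. -/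
noncomputable instance instFintypeDegreeLT (K : Type*) [Field K] [Fintype K] (e : ℕ) :
    Fintype (Polynomial.degreeLT K e) :=
  Fintype.ofEquiv (Fin e → K) (Polynomial.degreeLTEquiv K e).toEquiv.symm

/-- The Nisan-Wigderson polynomial `NW_{d,m,e}` with coefficients in `F`, where `m` is the number
of elements of the finite field `K` and `ι` names the `d` distinct evaluation points in `K`:
the sum, over all `p ∈ K[t]` of degree less than `e` (including `p = 0`), of the monomials
`x_{1,p(1)} ⋯ x_{d,p(d)}`.  Its variables are indexed by `Fin d × K`. -/
noncomputable def nisanWigderson (F : Type*) [Field F] (K : Type*) [Field K] [Fintype K]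
    (d e : ℕ) (ι : Fin d ↪ K) : MvPolynomial (Fin d × K) F :=
  ∑ p : Polynomial.degreeLT K e,
    ∏ i : Fin d, MvPolynomial.X (i, (p : Polynomial K).eval (ι i))

/-- Partial derivatives commute. -/
theorem pderiv_leftComm {σ F : Type*} [Field F] (i j : σ) (P : MvPolynomial σ F) :
    MvPolynomial.pderiv i (MvPolynomial.pderiv j P) =
      MvPolynomial.pderiv j (MvPolynomial.pderiv i P) := by
  classical
  have h : ⁅MvPolynomial.pderiv (R := F) i, MvPolynomial.pderiv (R := F) j⁆ = 0 := by
    refine MvPolynomial.derivation_ext fun l => ?_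
    rw [Derivation.commutator_apply]
    simp only [MvPolynomial.pderiv_X, Pi.single_apply]
    split_ifs <;> simp
  have h2 := congrArg (fun D => D P) h
  simpa [Derivation.commutator_apply, sub_eq_zero] using h2

instance instLeftCommutativePderiv {σ F : Type*} [Field F] :
    LeftCommutative (fun (i : σ) (P : MvPolynomial σ F) => MvPolynomial.pderiv i P) :=
  ⟨fun i j P => pderiv_leftComm i j P⟩

/-- The iterated (formal) partial derivative `∂_{x^α} P`, of order `α.degree`. -/
noncomputable def monomialDeriv {σ F : Type*} [Field F] (α : σ →₀ ℕ) (P : MvPolynomial σ F) :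
    MvPolynomial σ F :=
  (Finsupp.toMultiset α).foldr (fun i Q => MvPolynomial.pderiv i Q) P

/-- The shifted partial derivative `x^β · ∂_{x^α} P`. -/
noncomputable def shiftedDeriv {σ F : Type*} [Field F] (α β : σ →₀ ℕ) (P : MvPolynomial σ F) :
    MvPolynomial σ F :=
  MvPolynomial.monomial β 1 * monomialDeriv α P

open Classical in
/-- `mult f`: the polynomial `f` restricted to its multilinear monomials. -/
noncomputable def multPart {σ F : Type*} [Field F] (f : MvPolynomial σ F) : MvPolynomial σ F :=
  ∑ u ∈ f.support with ∀ i, u i ≤ 1, MvPolynomial.monomial u (f.coeff u)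

/-- The dimension of the space of projected shifted partial derivatives: the dimension of the span
of all `mult (x^β · ∂_{x^α} P)` with `x^α` of degree `k` and `x^β` of degree `ℓ`. -/
noncomputable def projShiftedDim {σ F : Type*} [Field F] (k ℓ : ℕ) (P : MvPolynomial σ F) : ℕ :=
  Set.finrank F {g : MvPolynomial σ F | ∃ α β : σ →₀ ℕ,
    α.degree = k ∧ β.degree = ℓ ∧ g = multPart (shiftedDeriv α β P)}

/-- The multilinearization of `Q` with respect to the translated cube `c + {0,1}^n`: each power
`x_i^u` is replaced by the polynomial of degree at most one in `x_i` that agrees with it at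
`x_i = c_i` and at `x_i = c_i + 1`. -/
noncomputable def multilinearize {σ F : Type*} [Fintype σ] [Field F] (c : σ → F)
    (Q : MvPolynomial σ F) : MvPolynomial σ F :=
  ∑ u ∈ Q.support, MvPolynomial.C (Q.coeff u) *
    ∏ i, (MvPolynomial.C (c i ^ u i) +
      (MvPolynomial.X i - MvPolynomial.C (c i)) * MvPolynomial.C ((c i + 1) ^ u i - c i ^ u i))

/-- `multilinearize c Q` agrees with `Q` at all points of `c + {0,1}^n`. -/
theorem eval_multilinearize {σ F : Type*} [Fintype σ] [Field F] (c a : σ → F)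
    (ha : ∀ i, a i = c i ∨ a i = c i + 1) (Q : MvPolynomial σ F) :
    MvPolynomial.eval a (multilinearize c Q) = MvPolynomial.eval a Q := by
  rw [MvPolynomial.eval_eq' a Q]
  simp only [multilinearize, map_sum, map_mul, map_prod, map_add, map_sub,
    MvPolynomial.eval_C, MvPolynomial.eval_X]
  refine Finset.sum_congr rfl fun u _ => ?_
  congr 1
  refine Finset.prod_congr rfl fun i _ => ?_
  rcases ha i with h | h <;> rw [h] <;> ring

/-- The matrix `C_{k,ℓ}(P)` with respect to the translated cube `c + {0,1}^n`.  Rows are indexed by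
a derivative `∂_{x^α}` of order `k` and a monomial `x^β` of degree `ℓ`, columns by the multilinear
monomials `∏_{i ∈ s} x_i` of degree at most `t`; the entries are the coefficients of these monomials
in the multilinearizations of the `x^β · ∂_{x^α} P`. -/
noncomputable def shiftedMatrix {σ F : Type*} [Fintype σ] [Field F] (c : σ → F) (k ℓ t : ℕ)
    (P : MvPolynomial σ F) :
    Matrix ({α : σ →₀ ℕ // α.degree = k} × {β : σ →₀ ℕ // β.degree = ℓ})
      {s : Finset σ // s.card ≤ t} F :=
  Matrix.of fun r s =>
    (multilinearize c (shiftedDeriv r.1.1 r.2.1 P)).coeff (∑ i ∈ s.1, Finsupp.single i 1)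

/-- The submatrix `C'_{k,ℓ}(P)` of `C_{k,ℓ}(P)` whose rows are those with `x^β` multilinear and
whose columns are those of degree exactly `t`. -/
noncomputable def projShiftedMatrix {σ F : Type*} [Fintype σ] [Field F] (c : σ → F) (k ℓ t : ℕ)
    (P : MvPolynomial σ F) :
    Matrix ({α : σ →₀ ℕ // α.degree = k} × {β : σ →₀ ℕ // β.degree = ℓ ∧ ∀ i, β i ≤ 1})
      {s : Finset σ // s.card = t} F :=
  (shiftedMatrix c k ℓ t P).submatrix (fun r => (r.1, ⟨r.2.1, r.2.2.1⟩))
    (fun s => ⟨s.1, s.2.le⟩)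

/-- The constraints on the parameters: `m = Θ(d²)` and `ε = Θ(log d / √d)`, with
`m^k ≥ (1+ε)^{2(d-k)}` and `m^{e-k} = (2/(1+ε))^{d-k} · poly(m)`, where the implied constants are
`c₁, c₂` for `m`, `c₃, c₄` for `ε`, and `poly(m)` lies between `m^{-A}` and `m^A`. -/
structure ParamsInZone (c₁ c₂ c₃ c₄ A : ℝ) (d k m e : ℕ) (ε : ℝ) : Prop where
  m_lower : c₁ * (d : ℝ) ^ 2 ≤ m
  m_upper : (m : ℝ) ≤ c₂ * (d : ℝ) ^ 2
  eps_lower : c₃ * (Real.log d / Real.sqrt d) ≤ ε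
  eps_upper : ε ≤ c₄ * (Real.log d / Real.sqrt d)
  pow_k : (1 + ε) ^ (2 * ((d : ℤ) - k)) ≤ (m : ℝ) ^ k
  pow_e_lower : (2 / (1 + ε)) ^ ((d : ℤ) - k) * (m : ℝ) ^ (-A) ≤ (m : ℝ) ^ ((e : ℤ) - k)
  pow_e_upper : (m : ℝ) ^ ((e : ℤ) - k) ≤ (2 / (1 + ε)) ^ ((d : ℤ) - k) * (m : ℝ) ^ A

/-! The rank bound is a count of leading monomials, carried out by second moments. Put `D = d - k`
and `t = ℓ + D`, and let `H` be the first `k` points. Differentiating by the graph over `H` of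
values `a` leaves the polynomials `p` through those values, each contributing the graph of `p` over
`Hᶜ`. After multiplication by the monomial of an `ℓ`-set `b`, the multilinear monomials of the row
`(a, b)` are the sets `b ∪ graph(p)` with the graph disjoint from `b`. All their coefficients are 1,
so the characteristic of `F` plays no role. Under any total order of the monomials, rows with
distinct leading monomials are independent (`card_pivots_le_finrank`), so it suffices to find many
leading monomials.

Two expectations govern the count. Up to the difference between hypergeometric and binomial
probabilities, `μ = m^(e-k) ((n-ℓ)/n)^D` is the expected number of polynomials through `a` whose
graph avoids a random `b`, and `lam = m^e (t/n)^D` is the expected number of graphs over `Hᶜ` inside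
a random `t`-set. Two polynomials of degree less than `e` rarely agree in many points
(`sum_pow_card_graphOver_inter_le`), so second moments are close to squared first moments, up to a
diagonal term. This has two consequences. A fraction of order `μ / (2μ + 1)` of all rows is nonzero
(`le_card_nonzeroRows`). A leading monomial `S` comes from at most as many rows as there are graphs
inside `S`, which Cauchy–Schwarz controls on average (`sq_card_nonzeroRows_le`). Together they yield
`le_card_image_lead`: the number of leading monomials is at least `choose n t` times `lam / (64
(2μ+1)² (2 lam+1))`.

For parameters in the zone, `μ ≤ 3 m^A`, while `lam ≥ m^(-A) (1 - ε²)^D`, because the surplus `m^k ≥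
(1+ε)^(2D)` turns `((1-ε)/(1+ε))^D` into `(1-ε²)^D`. As `D ε² = O(log² d)` and `m = O(d²)`, the loss
is `exp(-O(log² d))`. -/

/-! ### Random sets of fixed size: first and second moments -/

open Finset in
/-- The number of `s`-element sets that contain a given `r`-element set. -/
theorem card_superset_mul_descFactorial {σ : Type*} [Fintype σ] [DecidableEq σ] (A : Finset σ)
    (s : ℕ) :
    #{S ∈ powersetCard s (univ : Finset σ) | A ⊆ S} * (Fintype.card σ).descFactorial #A =
      (Fintype.card σ).choose s * s.descFactorial #A := by
  rcases lt_or_ge s #A with h | h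
  · rw [Nat.descFactorial_of_lt h, mul_zero, mul_eq_zero, card_eq_zero, filter_eq_empty_iff]
    left
    intro S hS hA
    have := card_le_card hA
    rw [mem_powersetCard] at hS
    omega
  · have hc : #{S ∈ powersetCard s (univ : Finset σ) | A ⊆ S} =
        (Fintype.card σ - #A).choose (s - #A) := by
      rw [← card_compl, ← card_powersetCard]
      refine card_nbij' (fun S => S \ A) (fun S => S ∪ A) ?_ ?_ ?_ ?_
      · intro S hS
        simp only [coe_filter, mem_powersetCard, Set.mem_ofPred_eq] at hS
        simp only [mem_coe, mem_powersetCard]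
        refine ⟨fun x hx => by simpa using (mem_sdiff.1 hx).2, ?_⟩
        rw [card_sdiff_of_subset hS.2, hS.1.2]
      · intro S hS
        simp only [mem_coe, mem_powersetCard] at hS
        simp only [coe_filter, mem_powersetCard, Set.mem_ofPred_eq, subset_univ, true_and,
          subset_union_right, and_true]
        rw [card_union_of_disjoint, hS.2, Nat.sub_add_cancel h]
        exact disjoint_left.2 fun x hx => by simpa using hS.1 hx
      · intro S hS
        simp only [coe_filter, mem_powersetCard, Set.mem_ofPred_eq] at hS
        exact sdiff_union_of_subset hS.2
      · intro S hS
        simp only [mem_coe, mem_powersetCard] at hS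
        refine union_sdiff_cancel_right (disjoint_left.2 fun x hx => by simpa using hS.1 hx)
    have h1 := Nat.choose_mul (n := Fintype.card σ) h
    rw [hc, Nat.descFactorial_eq_factorial_mul_choose, Nat.descFactorial_eq_factorial_mul_choose,
      mul_left_comm ((Fintype.card σ).choose s), h1]
    ring

/-- Factor by factor, `(s - j) / (n - j) ≤ s / n` because `s ≤ n`. -/
theorem descFactorial_mul_pow_le {s n : ℕ} (h : s ≤ n) (r : ℕ) :
    s.descFactorial r * n ^ r ≤ n.descFactorial r * s ^ r := by
  induction r with
  | zero => simp
  | succ r ih =>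
    rw [Nat.descFactorial_succ, Nat.descFactorial_succ, pow_succ, pow_succ]
    have h1 : (s - r) * n ≤ (n - r) * s := by
      rw [Nat.sub_mul, Nat.sub_mul, mul_comm n s]
      exact Nat.sub_le_sub_left (Nat.mul_le_mul_left r h) _
    calc (s - r) * s.descFactorial r * (n ^ r * n)
        = ((s - r) * n) * (s.descFactorial r * n ^ r) := by ring
      _ ≤ ((n - r) * s) * (n.descFactorial r * s ^ r) := Nat.mul_le_mul h1 ih
      _ = _ := by ring

/-- By Bernoulli's inequality, `(1 - r/s)^r ≥ 1 - r²/s ≥ 1/2`. -/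
theorem pow_le_two_mul_descFactorial {s r : ℕ} (h : 2 * r ^ 2 ≤ s) :
    s ^ r ≤ 2 * s.descFactorial r := by
  rcases Nat.eq_zero_or_pos s with rfl | hs
  · have : r = 0 := by nlinarith
    subst this
    simp
  have hr : r ≤ s := by nlinarith
  have h1 := Nat.pow_sub_le_descFactorial s r
  have hs' : (0 : ℝ) < s := by exact_mod_cast hs
  have hrs : (r : ℝ) / s ≤ 1 := by
    rw [div_le_one hs']
    exact_mod_cast hr
  have h2 : (1 : ℝ) / 2 ≤ (1 + -((r : ℝ) / s)) ^ r := by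
    have := one_add_mul_le_pow (a := -((r : ℝ) / s)) (by linarith) r
    refine le_trans ?_ this
    have h3 : (r : ℝ) * (r / s) ≤ 1 / 2 := by
      rw [← mul_div_assoc, div_le_iff₀ hs']
      have : (2 * r ^ 2 : ℝ) ≤ s := by exact_mod_cast h
      linarith
    linarith
  have h4 : (s : ℝ) ^ r ≤ 2 * ((s : ℝ) - r) ^ r := by
    have : (s : ℝ) - r = s * (1 + -((r : ℝ) / s)) := by field_simp; ring
    rw [this, mul_pow]
    nlinarith [pow_pos hs' r]
  have h5 : ((s - r : ℕ) : ℝ) ^ r ≤ s.descFactorial r := by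
    exact_mod_cast (Nat.pow_le_pow_left (by omega) r).trans h1
  rw [Nat.cast_sub hr] at h5
  have : (s : ℝ) ^ r ≤ 2 * s.descFactorial r := h4.trans (by linarith)
  exact_mod_cast this

open Finset in
theorem card_superset_le {σ : Type*} [Fintype σ] [DecidableEq σ] (A : Finset σ)
    {s : ℕ} (hs : s ≤ Fintype.card σ) :
    (#{S ∈ powersetCard s (univ : Finset σ) | A ⊆ S} : ℝ) ≤
      (Fintype.card σ).choose s * ((s : ℝ) / Fintype.card σ) ^ #A := by
  have h1 := card_superset_mul_descFactorial A s
  have h2 := descFactorial_mul_pow_le hs #A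
  have h3 : 0 < (Fintype.card σ).descFactorial #A :=
    Nat.pos_of_ne_zero fun h => by
      rw [Nat.descFactorial_eq_zero_iff_lt] at h
      exact absurd (card_le_univ A) (by omega)
  have hn : 0 < Fintype.card σ ^ #A := by
    rcases Nat.eq_zero_or_pos (Fintype.card σ) with h | h
    · have : #A = 0 := by have := card_le_univ A; omega
      simp [this]
    · exact pow_pos h _
  have h4 : #{S ∈ powersetCard s (univ : Finset σ) | A ⊆ S} * Fintype.card σ ^ #A ≤
      (Fintype.card σ).choose s * s ^ #A := by
    refine Nat.le_of_mul_le_mul_left ?_ h3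
    calc _ = (#{S ∈ powersetCard s (univ : Finset σ) | A ⊆ S} *
          (Fintype.card σ).descFactorial #A) * Fintype.card σ ^ #A := by ring
      _ = (Fintype.card σ).choose s * (s.descFactorial #A * Fintype.card σ ^ #A) := by
          rw [h1]; ring
      _ ≤ (Fintype.card σ).choose s * ((Fintype.card σ).descFactorial #A * s ^ #A) :=
          Nat.mul_le_mul_left _ h2
      _ = _ := by ring
  rw [div_pow, ← mul_div_assoc, le_div_iff₀ (by exact_mod_cast hn)]
  exact_mod_cast h4

-- Together with `card_superset_le`, this compares sampling without replacement to independent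
-- sampling with probability `s/n`, at the cost of a factor 2.
open Finset in
theorem le_card_superset {σ : Type*} [Fintype σ] [DecidableEq σ] (A : Finset σ)
    {s : ℕ} (hs : 2 * #A ^ 2 ≤ s) (hn : 0 < Fintype.card σ) :
    ((Fintype.card σ).choose s : ℝ) * ((s : ℝ) / Fintype.card σ) ^ #A ≤
      2 * #{S ∈ powersetCard s (univ : Finset σ) | A ⊆ S} := by
  have h1 := card_superset_mul_descFactorial A s
  have h2 := pow_le_two_mul_descFactorial hs
  have h3 := Nat.descFactorial_le_pow (Fintype.card σ) #A
  have h4 : (Fintype.card σ).choose s * s ^ #A ≤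
      2 * #{S ∈ powersetCard s (univ : Finset σ) | A ⊆ S} * Fintype.card σ ^ #A := by
    calc _ ≤ (Fintype.card σ).choose s * (2 * s.descFactorial #A) := Nat.mul_le_mul_left _ h2
      _ = 2 * (#{S ∈ powersetCard s (univ : Finset σ) | A ⊆ S} *
          (Fintype.card σ).descFactorial #A) := by rw [h1]; ring
      _ ≤ 2 * (#{S ∈ powersetCard s (univ : Finset σ) | A ⊆ S} * Fintype.card σ ^ #A) := by gcongr
      _ = _ := by ring
  rw [div_pow, ← mul_div_assoc, div_le_iff₀ (by positivity)]
  exact_mod_cast h4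

open Finset in
/-- Second moment of the number of members of a family of `D`-element sets that are contained in
a random `s`-element set. -/
theorem sum_sq_card_subset_le {σ J : Type*} [Fintype σ] [DecidableEq σ] (Q : Finset J)
    (T : J → Finset σ) {D s : ℕ} {κ : ℝ} (hs : s ≤ Fintype.card σ) (hs0 : 0 < s)
    (hT : ∀ q ∈ Q, #(T q) = D)
    (hκ : ∀ q ∈ Q, ∑ r ∈ Q, ((Fintype.card σ : ℝ) / s) ^ #(T q ∩ T r) ≤
      #Q * κ + ((Fintype.card σ : ℝ) / s) ^ D) :
    ∑ S ∈ powersetCard s (univ : Finset σ), (#{q ∈ Q | T q ⊆ S} : ℝ) ^ 2 ≤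
      (Fintype.card σ).choose s * ((#Q * ((s : ℝ) / Fintype.card σ) ^ D) ^ 2 * κ +
        #Q * ((s : ℝ) / Fintype.card σ) ^ D) := by
  set n := Fintype.card σ
  set ρ : ℝ := (s : ℝ) / n with hρ
  have hn : 0 < n := by omega
  have hs' : (0 : ℝ) < s := by exact_mod_cast hs0
  have hn' : (0 : ℝ) < n := by exact_mod_cast hn
  have hρ0 : 0 < ρ := by positivity
  have hx : (n : ℝ) / s = ρ⁻¹ := by rw [hρ, inv_div]
  rw [hx] at hκ
  have h1 : ∀ S : Finset σ, (#{q ∈ Q | T q ⊆ S} : ℝ) ^ 2 =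
      ∑ q ∈ Q, ∑ r ∈ Q, if T q ∪ T r ⊆ S then 1 else 0 := by
    intro S
    rw [card_filter, sq]
    push_cast
    rw [sum_mul_sum]
    refine sum_congr rfl fun q _ => sum_congr rfl fun r _ => ?_
    by_cases ha : T q ⊆ S <;> by_cases hb : T r ⊆ S <;> simp [union_subset_iff, ha, hb]
  have h2 : ∑ S ∈ powersetCard s (univ : Finset σ), (#{q ∈ Q | T q ⊆ S} : ℝ) ^ 2 =
      ∑ q ∈ Q, ∑ r ∈ Q, (#{S ∈ powersetCard s (univ : Finset σ) | T q ∪ T r ⊆ S} : ℝ) := by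
    simp_rw [h1]
    rw [sum_comm]
    refine sum_congr rfl fun q _ => ?_
    rw [sum_comm]
    refine sum_congr rfl fun r _ => ?_
    rw [card_filter]
    push_cast
    rfl
  -- Both sets lie in `S` with probability at most `ρ^(2D - |T q ∩ T r|)`, so only the sizes of the
  -- intersections matter.
  have h3 : ∀ q ∈ Q, ∑ r ∈ Q, (#{S ∈ powersetCard s (univ : Finset σ) | T q ∪ T r ⊆ S} : ℝ) ≤
      n.choose s * (ρ ^ (2 * D) * (#Q * κ + ρ⁻¹ ^ D)) := by
    intro q hq
    calc _ ≤ ∑ r ∈ Q, (n.choose s : ℝ) * (ρ ^ (2 * D) * ρ⁻¹ ^ #(T q ∩ T r)) := by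
          refine sum_le_sum fun r hr => (card_superset_le _ hs).trans (le_of_eq ?_)
          have hc : #(T q ∪ T r) + #(T q ∩ T r) = 2 * D := by
            rw [card_union_add_card_inter, hT q hq, hT r hr]; ring
          rw [← hc, pow_add, mul_assoc (ρ ^ _), ← mul_pow, mul_inv_cancel₀ hρ0.ne', one_pow,
            mul_one]
      _ = n.choose s * (ρ ^ (2 * D) * ∑ r ∈ Q, ρ⁻¹ ^ #(T q ∩ T r)) := by
          rw [mul_sum, mul_sum]
      _ ≤ _ := by gcongr; exact hκ q hq
  rw [h2]
  refine (sum_le_sum h3).trans (le_of_eq ?_)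
  rw [sum_const, nsmul_eq_mul]
  have : ρ ^ (2 * D) * ρ⁻¹ ^ D = ρ ^ D := by
    rw [two_mul, pow_add, mul_assoc, ← mul_pow, mul_inv_cancel₀ hρ0.ne', one_pow, mul_one]
  linear_combination (#Q : ℝ) * n.choose s * this

open Finset in
/-- Many `s`-element sets contain a member of a family whose members intersect little. -/
theorem le_card_superset_of_mem {σ J : Type*} [Fintype σ] [DecidableEq σ] (Q : Finset J)
    (T : J → Finset σ) {D s : ℕ} (hs : s ≤ Fintype.card σ) (hs0 : 0 < s) (hD : 2 * D ^ 2 ≤ s)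
    (hT : ∀ q ∈ Q, #(T q) = D)
    (hκ : ∀ q ∈ Q, ∑ r ∈ Q, ((Fintype.card σ : ℝ) / s) ^ #(T q ∩ T r) ≤
      #Q * 2 + ((Fintype.card σ : ℝ) / s) ^ D) {μ : ℝ}
    (hμ : #Q * ((s : ℝ) / Fintype.card σ) ^ D = μ) :
    (Fintype.card σ).choose s * μ ≤
      4 * (2 * μ + 1) * #{S ∈ powersetCard s (univ : Finset σ) | ∃ q ∈ Q, T q ⊆ S} := by
  set n := Fintype.card σ
  have hn : 0 < n := by omega
  have h1 := sum_sq_card_subset_le Q T hs hs0 hT hκ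
  rw [hμ] at h1
  have hμ0 : 0 ≤ μ := by rw [← hμ]; positivity
  have h2 : n.choose s * μ ≤
      2 * ∑ S ∈ powersetCard s (univ : Finset σ), (#{q ∈ Q | T q ⊆ S} : ℝ) := by
    calc (n.choose s : ℝ) * μ = ∑ q ∈ Q, (n.choose s : ℝ) * ((s : ℝ) / n) ^ D := by
          rw [sum_const, nsmul_eq_mul, ← hμ]; ring
      _ ≤ ∑ q ∈ Q, 2 * (#{S ∈ powersetCard s (univ : Finset σ) | T q ⊆ S} : ℝ) := by
          refine sum_le_sum fun q hq => ?_
          have := le_card_superset (T q) (s := s) (by rw [hT q hq]; exact hD) hn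
          rwa [hT q hq] at this
      _ = _ := by
          rw [← mul_sum]
          congr 1
          simp_rw [card_filter]
          push_cast
          rw [sum_comm]
  -- The count vanishes unless `S` contains a member, so Cauchy–Schwarz is applied on the support
  -- alone.
  have h3 : (∑ S ∈ powersetCard s (univ : Finset σ), (#{q ∈ Q | T q ⊆ S} : ℝ)) ^ 2 ≤
      #{S ∈ powersetCard s (univ : Finset σ) | ∃ q ∈ Q, T q ⊆ S} *
        ∑ S ∈ powersetCard s (univ : Finset σ), (#{q ∈ Q | T q ⊆ S} : ℝ) ^ 2 := by
    have ha : ∑ S ∈ powersetCard s (univ : Finset σ), (#{q ∈ Q | T q ⊆ S} : ℝ) =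
        ∑ S ∈ powersetCard s (univ : Finset σ) with ∃ q ∈ Q, T q ⊆ S,
          (#{q ∈ Q | T q ⊆ S} : ℝ) := by
      symm
      refine sum_filter_of_ne fun S _ hne => ?_
      have : #{q ∈ Q | T q ⊆ S} ≠ 0 := by exact_mod_cast hne
      obtain ⟨q, hq⟩ := card_ne_zero.1 this
      exact ⟨q, (mem_filter.1 hq).1, (mem_filter.1 hq).2⟩
    rw [ha]
    refine sq_sum_le_card_mul_sum_sq.trans ?_
    gcongr
    exact filter_subset _ _
  set X := ∑ S ∈ powersetCard s (univ : Finset σ), (#{q ∈ Q | T q ⊆ S} : ℝ)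
  set G : ℝ := ((#{S ∈ powersetCard s (univ : Finset σ) | ∃ q ∈ Q, T q ⊆ S} : ℕ) : ℝ)
  have hC : (0 : ℝ) < n.choose s := by exact_mod_cast Nat.choose_pos hs
  rcases hμ0.eq_or_lt with h0 | h0
  · rw [← h0]
    have : 0 ≤ G := by positivity
    nlinarith
  · have h4 : (n.choose s * μ) ^ 2 ≤ 4 * (G * (n.choose s * (μ ^ 2 * 2 + μ))) := by
      have : (n.choose s * μ) ^ 2 ≤ (2 * X) ^ 2 := by gcongr
      have h5 : X ^ 2 ≤ G * (n.choose s * (μ ^ 2 * 2 + μ)) := h3.trans (by gcongr)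
      nlinarith
    have h6 : (0 : ℝ) < n.choose s * μ := by positivity
    refine le_of_mul_le_mul_left ?_ h6
    linarith

/-! ### Polynomials with prescribed values and their graphs -/

open Classical in
/-- The polynomials of degree less than `e` with prescribed values at the points named by `H`. -/
noncomputable def polysThrough {K : Type*} [Field K] [Fintype K] {d : ℕ} (ι : Fin d ↪ K) (e : ℕ)
    (H : Finset (Fin d)) (a : Fin d → K) : Finset (Polynomial.degreeLT K e) :=
  {p | ∀ i ∈ H, (p : Polynomial K).eval (ι i) = a i}

/-- The graph of the restriction of a function to `G`. -/
def graphOn {V : Type*} {d : ℕ} (G : Finset (Fin d)) (f : Fin d → V) : Finset (Fin d × V) :=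
  G.map ⟨fun i => (i, f i), fun _ _ h => congrArg Prod.fst h⟩

theorem mem_graphOn {V : Type*} {d : ℕ} {G : Finset (Fin d)} {f : Fin d → V} {x : Fin d × V} :
    x ∈ graphOn G f ↔ x.1 ∈ G ∧ x.2 = f x.1 := by
  rw [graphOn, Finset.mem_map]
  constructor
  · rintro ⟨i, hi, rfl⟩
    exact ⟨hi, rfl⟩
  · rintro ⟨h1, h2⟩
    exact ⟨x.1, h1, Prod.ext rfl h2.symm⟩

theorem card_graphOn {V : Type*} {d : ℕ} (G : Finset (Fin d)) (f : Fin d → V) :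
    (graphOn G f).card = G.card :=
  Finset.card_map _

/-- The part over `G` of the graph of a polynomial. -/
noncomputable def graphOver {K : Type*} [Field K] {d : ℕ} (ι : Fin d ↪ K)
    (G : Finset (Fin d)) (p : Polynomial K) : Finset (Fin d × K) :=
  graphOn G fun i => p.eval (ι i)

section

variable {K : Type*} [Field K] {d : ℕ} (ι : Fin d ↪ K)

theorem mem_graphOver {G : Finset (Fin d)} {p : Polynomial K} {x : Fin d × K} :
    x ∈ graphOver ι G p ↔ x.1 ∈ G ∧ x.2 = p.eval (ι x.1) :=
  mem_graphOn

theorem card_graphOver (G : Finset (Fin d)) (p : Polynomial K) : (graphOver ι G p).card = G.card :=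
  card_graphOn _ _

open Classical in
theorem card_graphOver_inter (G : Finset (Fin d)) (p q : Polynomial K) :
    (graphOver ι G p ∩ graphOver ι G q).card =
      (G.filter fun i => p.eval (ι i) = q.eval (ι i)).card := by
  rw [← card_graphOver ι _ p]
  congr 1
  ext x
  simp only [Finset.mem_inter, mem_graphOver, Finset.mem_filter]
  constructor
  · rintro ⟨⟨h1, h2⟩, -, h3⟩
    exact ⟨⟨h1, h2 ▸ h3⟩, h2⟩
  · rintro ⟨⟨h1, h2⟩, h3⟩
    exact ⟨⟨h1, h3⟩, h1, h2 ▸ h3⟩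

variable [Fintype K]

theorem mem_polysThrough {e : ℕ} {H : Finset (Fin d)} {a : Fin d → K}
    {p : Polynomial.degreeLT K e} :
    p ∈ polysThrough ι e H a ↔ ∀ i ∈ H, (p : Polynomial K).eval (ι i) = a i := by
  simp [polysThrough]

theorem card_degreeLT (e : ℕ) :
    Fintype.card (Polynomial.degreeLT K e) = Fintype.card K ^ e := by
  rw [Fintype.card_congr (Polynomial.degreeLTEquiv K e).toEquiv]
  simp

theorem exists_mem_polysThrough {e : ℕ} {H : Finset (Fin d)} (hH : H.card ≤ e) (a : Fin d → K) :
    ∃ p, p ∈ polysThrough ι e H a := by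
  refine ⟨⟨Lagrange.interpolate H ι a, ?_⟩, ?_⟩
  · rw [Polynomial.mem_degreeLT]
    exact (Lagrange.degree_interpolate_lt a ι.injective.injOn).trans_le (by exact_mod_cast hH)
  · rw [mem_polysThrough]
    intro i hi
    exact Lagrange.eval_interpolate_at_node a ι.injective.injOn hi

theorem eq_of_mem_polysThrough {e : ℕ} {H : Finset (Fin d)} (hH : e ≤ H.card) {a : Fin d → K}
    {p q : Polynomial.degreeLT K e} (hp : p ∈ polysThrough ι e H a)
    (hq : q ∈ polysThrough ι e H a) : p = q := by
  rw [mem_polysThrough] at hp hq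
  refine Subtype.ext (Polynomial.eq_of_degrees_lt_of_eval_index_eq H ι.injective.injOn
    ((Polynomial.mem_degreeLT.1 p.2).trans_le (by exact_mod_cast hH))
    ((Polynomial.mem_degreeLT.1 q.2).trans_le (by exact_mod_cast hH)) fun i hi => ?_)
  rw [hp i hi, hq i hi]

/-- Translation by one interpolating polynomial identifies the two sets. -/
theorem card_polysThrough_eq {e : ℕ} {H : Finset (Fin d)} (hH : H.card ≤ e) (a : Fin d → K) :
    (polysThrough ι e H a).card = (polysThrough ι e H 0).card := by
  obtain ⟨p, hp⟩ := exists_mem_polysThrough ι hH a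
  rw [mem_polysThrough] at hp
  refine Finset.card_nbij' (fun q => q - p) (fun q => q + p) ?_ ?_ ?_ ?_
  · intro q hq
    simp only [Finset.mem_coe, mem_polysThrough] at hq ⊢
    intro i hi
    simp [hq i hi, hp i hi]
  · intro q hq
    simp only [Finset.mem_coe, mem_polysThrough] at hq ⊢
    intro i hi
    simp [hq i hi, hp i hi]
  · intro q _
    simp
  · intro q _
    simp

open Classical in
/-- Representatives of the possible values at the points named by `H`. -/
noncomputable def valuesOn (K : Type*) [Field K] [Fintype K] {d : ℕ} (H : Finset (Fin d)) :
    Finset (Fin d → K) :=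
  Fintype.piFinset fun i => if i ∈ H then Finset.univ else {0}

theorem card_valuesOn (H : Finset (Fin d)) :
    (valuesOn K H).card = Fintype.card K ^ H.card := by
  classical
  rw [valuesOn, Fintype.card_piFinset]
  simp [apply_ite]

theorem eq_of_mem_valuesOn {H : Finset (Fin d)} {a b : Fin d → K} (ha : a ∈ valuesOn K H)
    (hb : b ∈ valuesOn K H) (h : ∀ i ∈ H, a i = b i) : a = b := by
  classical
  rw [valuesOn, Fintype.mem_piFinset] at ha hb
  funext i
  by_cases hi : i ∈ H
  · exact h i hi
  · have h1 := ha i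
    have h2 := hb i
    simp only [hi, if_false, Finset.mem_singleton] at h1 h2
    rw [h1, h2]

theorem card_polysThrough_mul {e : ℕ} {H : Finset (Fin d)} (hH : H.card ≤ e) (a : Fin d → K) :
    (polysThrough ι e H a).card * Fintype.card K ^ H.card = Fintype.card K ^ e := by
  classical
  rw [← card_degreeLT e, ← Finset.card_univ (α := Polynomial.degreeLT K e),
    Finset.card_eq_sum_card_fiberwise (s := Finset.univ) (t := valuesOn K H)
      (f := fun (p : Polynomial.degreeLT K e) i =>
        if i ∈ H then (p : Polynomial K).eval (ι i) else 0)]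
  · rw [← card_valuesOn, mul_comm, ← smul_eq_mul,
      ← Finset.sum_const (polysThrough ι e H a).card]
    refine Finset.sum_congr rfl fun b hb => ?_
    rw [card_polysThrough_eq ι hH a, ← card_polysThrough_eq ι hH b]
    congr 1
    ext p
    simp only [mem_polysThrough, Finset.mem_filter, Finset.mem_univ, true_and]
    constructor
    · intro h
      refine eq_of_mem_valuesOn (H := H) ?_ hb fun i hi => by simp [hi, h i hi]
      rw [valuesOn, Fintype.mem_piFinset]
      intro i
      by_cases hi : i ∈ H <;> simp [hi]
    · intro h i hi
      have := congrFun h i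
      simpa [hi] using this
  · intro p _
    simp only [valuesOn, Finset.mem_coe, Fintype.mem_piFinset]
    intro i
    by_cases hi : i ∈ H <;> simp [hi]

/-- While `|H ∪ I| ≤ e`, each further point divides the count by the field size. Beyond `e` points
at most one polynomial is left, which the summand 1 accounts for. -/
theorem card_polysThrough_union_le {e : ℕ} {H I : Finset (Fin d)} (hH : H.card ≤ e)
    (hI : Disjoint H I) (a b : Fin d → K) :
    ((polysThrough ι e (H ∪ I) b).card : ℝ) ≤
      (polysThrough ι e H a).card * ((Fintype.card K : ℝ)⁻¹) ^ I.card + 1 := by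
  have hm : (0 : ℝ) < Fintype.card K := by exact_mod_cast Fintype.card_pos
  rcases le_total (H ∪ I).card e with h | h
  · have h1 := card_polysThrough_mul ι h b
    rw [← card_polysThrough_mul ι hH a, Finset.card_union_of_disjoint hI, pow_add,
      mul_left_comm, mul_comm (polysThrough ι e H a).card] at h1
    have h2 := Nat.eq_of_mul_eq_mul_left (pow_pos Fintype.card_pos _) h1
    rw [← h2, inv_pow]
    push_cast
    rw [mul_assoc, mul_inv_cancel₀ (pow_pos hm _).ne', mul_one]
    linarith
  · have h1 : (polysThrough ι e (H ∪ I) b).card ≤ 1 :=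
      Finset.card_le_one.2 fun p hp q hq => eq_of_mem_polysThrough ι h hp hq
    have h2 : ((polysThrough ι e (H ∪ I) b).card : ℝ) ≤ 1 := by exact_mod_cast h1
    have h3 : 0 ≤ ((polysThrough ι e H a).card : ℝ) * ((Fintype.card K : ℝ)⁻¹) ^ I.card := by
      positivity
    linarith

open Classical in
/-- The graphs of polynomials of bounded degree intersect little on average. -/
theorem sum_pow_card_graphOver_inter_le {e : ℕ} {H G : Finset (Fin d)} (hH : H.card ≤ e)
    (hG : Disjoint H G) (a : Fin d → K) {x : ℝ} (hx : 1 ≤ x) {q : Polynomial.degreeLT K e}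
    (hq : q ∈ polysThrough ι e H a) :
    ∑ r ∈ polysThrough ι e H a,
        x ^ (graphOver ι G (q : Polynomial K) ∩ graphOver ι G (r : Polynomial K)).card ≤
      (polysThrough ι e H a).card * (1 + (x - 1) / Fintype.card K) ^ G.card + x ^ G.card := by
  -- Writing `x = (x - 1) + 1` replaces the size of the agreement set by a sum over its subsets `I`;
  -- agreement on a fixed `I` is then a count of polynomials.
  have h1 : ∀ s : Finset (Fin d), x ^ s.card = ∑ I ∈ s.powerset, (x - 1) ^ I.card := by
    intro s
    have := Finset.sum_pow_mul_eq_add_pow (x - 1) 1 s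
    simp only [one_pow, mul_one, sub_add_cancel] at this
    exact this.symm
  have h2 : ∀ r : Polynomial.degreeLT K e,
      x ^ (graphOver ι G (q : Polynomial K) ∩ graphOver ι G (r : Polynomial K)).card =
        ∑ I ∈ G.powerset, if ∀ i ∈ I, (q : Polynomial K).eval (ι i) = (r : Polynomial K).eval (ι i)
          then (x - 1) ^ I.card else 0 := by
    intro r
    rw [card_graphOver_inter, h1, ← Finset.sum_filter]
    refine Finset.sum_congr ?_ fun _ _ => rfl
    ext I
    simp only [Finset.mem_powerset, Finset.mem_filter, Finset.subset_iff]
    exact ⟨fun h => ⟨fun i hi => (h hi).1, fun i hi => (h hi).2⟩,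
      fun h i hi => ⟨h.1 hi, h.2 i hi⟩⟩
  simp_rw [h2]
  rw [Finset.sum_comm]
  have h3 : ∀ I ∈ G.powerset, (∑ r ∈ polysThrough ι e H a,
      if ∀ i ∈ I, (q : Polynomial K).eval (ι i) = (r : Polynomial K).eval (ι i)
        then (x - 1) ^ I.card else 0) ≤
      (polysThrough ι e H a).card * ((x - 1) / Fintype.card K) ^ I.card + (x - 1) ^ I.card := by
    intro I hI
    rw [← Finset.sum_filter, Finset.sum_const, nsmul_eq_mul]
    have hd : Disjoint H I := hG.mono_right (Finset.mem_powerset.1 hI)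
    have hs : (polysThrough ι e H a).filter (fun r : Polynomial.degreeLT K e =>
        ∀ i ∈ I, (q : Polynomial K).eval (ι i) = (r : Polynomial K).eval (ι i)) =
        polysThrough ι e (H ∪ I) fun i => (q : Polynomial K).eval (ι i) := by
      rw [mem_polysThrough] at hq
      ext r
      simp only [Finset.mem_filter, mem_polysThrough, Finset.mem_union, or_imp, forall_and]
      refine and_congr (forall₂_congr fun i hi => ?_) (forall₂_congr fun i _ => eq_comm)
      rw [hq i hi]
    rw [hs, div_eq_mul_inv, mul_pow]
    have h4 := card_polysThrough_union_le ι hH hd a fun i => (q : Polynomial K).eval (ι i)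
    have h5 : (0 : ℝ) ≤ (x - 1) ^ I.card := pow_nonneg (by linarith) _
    nlinarith
  refine (Finset.sum_le_sum h3).trans (le_of_eq ?_)
  rw [Finset.sum_add_distrib, ← Finset.mul_sum, h1 G]
  congr 2
  have := Finset.sum_pow_mul_eq_add_pow ((x - 1) / Fintype.card K) 1 G
  simp only [one_pow, mul_one] at this
  rw [this, add_comm]

end

/-! ### Coefficients of shifted derivatives and of multilinearizations -/

/-- The exponent of the multilinear monomial `∏_{i ∈ s} x_i`. -/
noncomputable def indExp {σ : Type*} (s : Finset σ) : σ →₀ ℕ := ∑ i ∈ s, Finsupp.single i 1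

theorem degree_indExp {σ : Type*} (s : Finset σ) : (indExp s).degree = s.card := by
  simp [indExp, map_sum]

section

variable {σ : Type*} [DecidableEq σ]

theorem indExp_apply (s : Finset σ) (x : σ) : indExp s x = if x ∈ s then 1 else 0 := by
  simp [indExp, Finsupp.finsetSum_apply, Finsupp.single_apply]

theorem indExp_le_one (s : Finset σ) (x : σ) : indExp s x ≤ 1 := by
  rw [indExp_apply]
  split_ifs <;> simp

theorem indExp_injective : Function.Injective (indExp (σ := σ)) := by
  intro s t h
  ext x
  have := DFunLike.congr_fun h x
  rw [indExp_apply, indExp_apply] at this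
  by_cases h1 : x ∈ s <;> by_cases h2 : x ∈ t <;> simp_all

theorem indExp_union {s t : Finset σ} (h : Disjoint s t) :
    indExp (s ∪ t) = indExp s + indExp t :=
  Finset.sum_union h

theorem indExp_le_iff {s t : Finset σ} : indExp s ≤ indExp t ↔ s ⊆ t := by
  constructor
  · intro h x hx
    have := h x
    rw [indExp_apply, indExp_apply, if_pos hx] at this
    by_contra h2
    simp [h2] at this
  · intro h x
    rw [indExp_apply, indExp_apply]
    by_cases hx : x ∈ s
    · simp [hx, h hx]
    · simp [hx]

theorem indExp_sub {s t : Finset σ} (h : s ⊆ t) : indExp t - indExp s = indExp (t \ s) := by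
  have h1 := indExp_union (Finset.sdiff_disjoint : Disjoint (t \ s) s)
  rw [Finset.sdiff_union_of_subset h] at h1
  rw [h1, add_tsub_cancel_right]

end

section

variable {σ F : Type*} [Field F]

/-- The constant is a product of exponents. It equals 1 for a squarefree derivative whose variables
do not occur in `u`, which keeps the later arguments independent of the characteristic. -/
theorem coeff_foldr_pderiv [DecidableEq σ] (P : MvPolynomial σ F) (s : Multiset σ) :
    ∀ u : σ →₀ ℕ, ∃ c : F,
      (s.foldr (fun i Q => MvPolynomial.pderiv i Q) P).coeff u =
        c * P.coeff (u + Multiset.toFinsupp s) ∧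
      (s.Nodup → (∀ i ∈ s, u i = 0) → c = 1) := by
  induction s using Multiset.induction with
  | empty => exact fun u => ⟨1, by simp, fun _ _ => rfl⟩
  | cons i s ih =>
    intro u
    obtain ⟨c, hc, hc1⟩ := ih (u + Finsupp.single i 1)
    refine ⟨c * (u i + 1), ?_, ?_⟩
    · rw [Multiset.foldr_cons, MvPolynomial.coeff_pderiv, hc, ← Multiset.singleton_add i s,
        map_add, Multiset.toFinsupp_singleton, add_assoc]
      ring
    · intro hn hu
      rw [Multiset.nodup_cons] at hn
      rw [hu i (Multiset.mem_cons_self i s), hc1 hn.2]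
      · simp
      · intro j hj
        have hij : i ≠ j := fun h => hn.1 (h ▸ hj)
        simp [hu j (Multiset.mem_cons_of_mem hj), hij]

theorem coeff_monomialDeriv (α u : σ →₀ ℕ) (P : MvPolynomial σ F) :
    ∃ c : F, (monomialDeriv α P).coeff u = c * P.coeff (u + α) := by
  classical
  obtain ⟨c, hc, -⟩ := coeff_foldr_pderiv P (Finsupp.toMultiset α) u
  rw [Finsupp.toMultiset_toFinsupp] at hc
  exact ⟨c, hc⟩

theorem coeff_monomialDeriv_indExp (A B : Finset σ) (h : Disjoint A B) (P : MvPolynomial σ F) :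
    (monomialDeriv (indExp A) P).coeff (indExp B) = P.coeff (indExp B + indExp A) := by
  classical
  obtain ⟨c, hc, hc1⟩ := coeff_foldr_pderiv P (Finsupp.toMultiset (indExp A)) (indExp B)
  rw [Finsupp.toMultiset_toFinsupp] at hc
  have hA : Finsupp.toMultiset (indExp A) = A.val := by
    rw [indExp, Finsupp.toMultiset_sum_single, one_nsmul]
  rw [hA] at hc1 hc
  have h1 := hc1 A.nodup fun i hi => by
    rw [indExp_apply, if_neg (Finset.disjoint_left.1 h hi)]
  rw [h1, one_mul] at hc
  rw [← hc, monomialDeriv, hA]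

theorem coeff_shiftedDeriv (α β u : σ →₀ ℕ) (P : MvPolynomial σ F) [Decidable (β ≤ u)] :
    (shiftedDeriv α β P).coeff u =
      if β ≤ u then (monomialDeriv α P).coeff (u - β) else 0 := by
  rw [shiftedDeriv, MvPolynomial.coeff_monomial_mul', one_mul]
  congr

theorem degree_of_mem_support_shiftedDeriv {α β u : σ →₀ ℕ} {P : MvPolynomial σ F} {d : ℕ}
    (hP : ∀ v, P.coeff v ≠ 0 → v.degree = d) (hu : (shiftedDeriv α β P).coeff u ≠ 0) :
    u.degree + α.degree = β.degree + d := by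
  classical
  rw [coeff_shiftedDeriv] at hu
  split_ifs at hu with h
  · obtain ⟨c, hc⟩ := coeff_monomialDeriv α (u - β) P
    rw [hc] at hu
    have h1 := hP _ (right_ne_zero_of_mul hu)
    rw [map_add] at h1
    have h2 : u.degree = (u - β).degree + β.degree := by
      rw [← map_add, tsub_add_cancel_of_le h]
    omega
  · exact absurd rfl hu

theorem coeff_multPart (f : MvPolynomial σ F) (s : Finset σ) :
    (multPart f).coeff (indExp s) = f.coeff (indExp s) := by
  classical
  rw [multPart, MvPolynomial.coeff_sum]
  simp only [MvPolynomial.coeff_monomial]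
  rw [Finset.sum_ite_eq']
  split_ifs with h
  · rfl
  · by_contra h2
    exact h (Finset.mem_filter.2 ⟨MvPolynomial.mem_support_iff.2 (Ne.symm h2), indExp_le_one s⟩)

theorem coeff_indExp_prod_add_mul_X [Fintype σ] [DecidableEq σ] (a b : σ → F) (s : Finset σ) :
    (∏ i, (MvPolynomial.C (b i) * MvPolynomial.X i + MvPolynomial.C (a i))).coeff (indExp s) =
      (∏ i ∈ s, b i) * ∏ i ∈ sᶜ, a i := by
  have h : ∀ t : Finset σ, (∏ i ∈ t, (MvPolynomial.C (b i) * MvPolynomial.X i)) *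
      ∏ i ∈ Finset.univ \ t, MvPolynomial.C (a i) =
        MvPolynomial.monomial (indExp t) ((∏ i ∈ t, b i) * ∏ i ∈ tᶜ, a i) := by
    intro t
    rw [Finset.prod_mul_distrib, ← map_prod, ← map_prod, ← Finset.compl_eq_univ_sdiff]
    have : ∏ i ∈ t, (MvPolynomial.X i : MvPolynomial σ F) =
        MvPolynomial.monomial (indExp t) 1 := by
      rw [indExp, MvPolynomial.monomial_sum_one]
      rfl
    rw [this, mul_right_comm, ← map_mul, MvPolynomial.C_mul_monomial, mul_one]
  rw [Finset.prod_add, MvPolynomial.coeff_sum]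
  simp only [h, MvPolynomial.coeff_monomial, indExp_injective.eq_iff]
  simp

/-- Multilinearization does not change the multilinear part of top degree. -/
theorem coeff_multilinearize [Fintype σ] (c : σ → F) {Q : MvPolynomial σ F} {s : Finset σ}
    (hQ : ∀ u, Q.coeff u ≠ 0 → u.degree = s.card) :
    (multilinearize c Q).coeff (indExp s) = Q.coeff (indExp s) := by
  classical
  have h : ∀ u ∈ Q.support, (MvPolynomial.C (Q.coeff u) *
      ∏ i, (MvPolynomial.C (c i ^ u i) + (MvPolynomial.X i - MvPolynomial.C (c i)) *
        MvPolynomial.C ((c i + 1) ^ u i - c i ^ u i))).coeff (indExp s) =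
      if u = indExp s then Q.coeff u else 0 := by
    intro u hu
    have h1 : ∀ i, (MvPolynomial.C (c i ^ u i) + (MvPolynomial.X i - MvPolynomial.C (c i)) *
        MvPolynomial.C ((c i + 1) ^ u i - c i ^ u i) : MvPolynomial σ F) =
        MvPolynomial.C ((c i + 1) ^ u i - c i ^ u i) * MvPolynomial.X i +
          MvPolynomial.C (c i ^ u i - c i * ((c i + 1) ^ u i - c i ^ u i)) := by
      intro i
      simp only [map_sub, map_mul]
      ring
    simp only [h1]
    rw [MvPolynomial.coeff_C_mul, coeff_indExp_prod_add_mul_X]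
    split_ifs with he
    · rw [Finset.prod_eq_one, Finset.prod_eq_one, mul_one, mul_one]
      · intro i hi
        rw [he, indExp_apply, if_neg (Finset.mem_compl.1 hi)]
        simp
      · intro i hi
        rw [he, indExp_apply, if_pos hi]
        simp
    · have hd := hQ u (MvPolynomial.mem_support_iff.1 hu)
      -- A different exponent of the same degree must miss some `i ∈ s`. There the factor is the
      -- constant 1, so no term with `x_i` arises.
      obtain ⟨i, hi, hi0⟩ : ∃ i ∈ s, u i = 0 := by
        by_contra! hne
        apply he
        have hle : indExp s ≤ u := by
          intro i
          rw [indExp_apply]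
          split_ifs with hi
          · exact Nat.one_le_iff_ne_zero.2 (hne i hi)
          · exact Nat.zero_le _
        have h2 : (u - indExp s).degree + (indExp s).degree = u.degree := by
          rw [← map_add, tsub_add_cancel_of_le hle]
        rw [degree_indExp, hd] at h2
        have h3 : (u - indExp s).degree = 0 := by omega
        rw [Finsupp.degree_eq_zero_iff] at h3
        rw [← tsub_add_cancel_of_le hle, h3, zero_add]
      rw [Finset.prod_eq_zero hi, zero_mul, mul_zero]
      simp [hi0]
  rw [multilinearize, MvPolynomial.coeff_sum, Finset.sum_congr rfl h, Finset.sum_ite_eq']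
  split_ifs with h2
  · rfl
  · exact (MvPolynomial.notMem_support_iff.1 h2).symm

/-! ### Rank from leading positions -/

/-- The dimension of a space of vectors is at least the number of their leading positions. -/
theorem card_pivots_le_finrank {V C : Type*} [AddCommGroup V] [Module F V] (φ : V →ₗ[F] C → F)
    (W : Submodule F V) [FiniteDimensional F W] {ord : C → ℕ} (hord : Function.Injective ord)
    (L : Finset C)
    (hL : ∀ s ∈ L, ∃ v ∈ W, φ v s ≠ 0 ∧ ∀ s', ord s < ord s' → φ v s' = 0) :
    L.card ≤ Module.finrank F W := by
  classical
  choose! v hvW hv0 hv using hL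
  have hli : LinearIndependent F fun s : L => (⟨v s, hvW s s.2⟩ : W) := by
    rw [Fintype.linearIndependent_iff]
    intro g hg
    by_contra! hne
    obtain ⟨s₀, hs₀⟩ := hne
    -- In a vanishing combination, the largest leading position with a nonzero coefficient receives
    -- no other contribution.
    obtain ⟨s, hs, hmax⟩ := Finset.exists_max_image
      (Finset.univ.filter fun s : L => g s ≠ 0) (fun s => ord s) ⟨s₀, by simpa using hs₀⟩
    have h1 : ∑ s : L, g s • v s = 0 := by
      have := congrArg (fun w : W => (w : V)) hg
      simpa using this
    have h2 := congrFun (congrArg φ h1) (s : C)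
    simp only [map_sum, map_smul, map_zero, Finset.sum_apply, Pi.smul_apply, smul_eq_mul,
      Pi.zero_apply] at h2
    rw [Finset.sum_eq_single s] at h2
    · exact (mul_ne_zero (Finset.mem_filter.1 hs).2 (hv0 s s.2)) h2
    · intro r _ hrs
      by_cases hr : g r = 0
      · rw [hr, zero_mul]
      · rw [hv r r.2, mul_zero]
        refine lt_of_le_of_ne (hmax r (by simpa using hr)) fun h => hrs ?_
        exact Subtype.ext (hord h)
    · simp
  simpa using hli.fintype_card_le_finrank

theorem card_pivots_le_rank {R C : Type*} [Finite R] [Fintype C] (A : Matrix R C F) {ord : C → ℕ}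
    (hord : Function.Injective ord) (L : Finset C)
    (hL : ∀ s ∈ L, ∃ r, A r s ≠ 0 ∧ ∀ s', ord s < ord s' → A r s' = 0) : L.card ≤ A.rank := by
  rw [Matrix.rank_eq_finrank_span_row]
  refine card_pivots_le_finrank LinearMap.id _ hord L fun s hs => ?_
  obtain ⟨r, hr⟩ := hL s hs
  exact ⟨A r, Submodule.subset_span ⟨r, rfl⟩, hr⟩

end

/-! ### Shifted derivatives of the Nisan–Wigderson polynomial -/

open Classical in
theorem graphOver_univ_eq {K : Type*} [Field K] {d : ℕ} (ι : Fin d ↪ K)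
    {H : Finset (Fin d)} {a : Fin d → K} {p : Polynomial K}
    (h : ∀ i ∈ H, p.eval (ι i) = a i) :
    graphOver ι Finset.univ p = graphOver ι Hᶜ p ∪ graphOn H a ∧
      Disjoint (graphOver ι Hᶜ p) (graphOn H a) := by
  constructor
  · ext x
    simp only [Finset.mem_union, mem_graphOver, mem_graphOn, Finset.mem_univ, true_and,
      Finset.mem_compl]
    by_cases hx : x.1 ∈ H
    · simp [hx, h _ hx]
    · simp [hx]
  · rw [Finset.disjoint_left]
    intro x hx hx2
    rw [mem_graphOver, Finset.mem_compl] at hx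
    exact hx.1 (mem_graphOn.1 hx2).1

section

variable {F : Type*} [Field F] {K : Type*} [Field K] [Fintype K] {d e : ℕ} (ι : Fin d ↪ K)

open Classical in
theorem coeff_nisanWigderson (u : Fin d × K →₀ ℕ) :
    (nisanWigderson F K d e ι).coeff u = ∑ p : Polynomial.degreeLT K e,
      if indExp (graphOver ι Finset.univ (p : Polynomial K)) = u then 1 else 0 := by
  rw [nisanWigderson, MvPolynomial.coeff_sum]
  refine Finset.sum_congr rfl fun p _ => ?_
  have : ∏ i : Fin d, (MvPolynomial.X (i, (p : Polynomial K).eval (ι i)) :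
      MvPolynomial (Fin d × K) F) =
      MvPolynomial.monomial (indExp (graphOver ι Finset.univ (p : Polynomial K))) 1 := by
    rw [indExp, MvPolynomial.monomial_sum_one, graphOver, graphOn, Finset.prod_map]
    rfl
  rw [this, MvPolynomial.coeff_monomial]

theorem exists_of_coeff_nisanWigderson_ne_zero {u : Fin d × K →₀ ℕ}
    (h : (nisanWigderson F K d e ι).coeff u ≠ 0) :
    ∃ p : Polynomial.degreeLT K e, indExp (graphOver ι Finset.univ (p : Polynomial K)) = u := by
  classical
  rw [coeff_nisanWigderson] at h
  obtain ⟨p, -, hp⟩ := Finset.exists_ne_zero_of_sum_ne_zero h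
  exact ⟨p, by by_contra h2; simp [h2] at hp⟩

theorem degree_of_coeff_nisanWigderson_ne_zero {u : Fin d × K →₀ ℕ}
    (h : (nisanWigderson F K d e ι).coeff u ≠ 0) : u.degree = d := by
  classical
  obtain ⟨p, rfl⟩ := exists_of_coeff_nisanWigderson_ne_zero ι h
  rw [degree_indExp, card_graphOver, Finset.card_univ, Fintype.card_fin]

/-- As `e ≤ d`, a polynomial is determined by its values at the `d` points, so no two monomials
coincide. -/
theorem coeff_nisanWigderson_graphOver (he : e ≤ d) (p : Polynomial.degreeLT K e) :
    (nisanWigderson F K d e ι).coeff (indExp (graphOver ι Finset.univ (p : Polynomial K))) =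
      1 := by
  classical
  rw [coeff_nisanWigderson, Finset.sum_eq_single p, if_pos rfl]
  · intro q _ hqp
    rw [if_neg]
    intro h
    apply hqp
    have h1 := indExp_injective h
    refine eq_of_mem_polysThrough ι (H := Finset.univ) (by simpa using he)
      (a := fun i => (p : Polynomial K).eval (ι i)) ?_ ?_
    · rw [mem_polysThrough]
      intro i _
      have : (i, (q : Polynomial K).eval (ι i)) ∈ graphOver ι Finset.univ (q : Polynomial K) :=
        (mem_graphOver ι).2 ⟨Finset.mem_univ _, rfl⟩
      rw [h1, mem_graphOver] at this
      exact this.2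
    · rw [mem_polysThrough]
      exact fun _ _ => rfl
  · simp

open Classical in
theorem coeff_shiftedDeriv_nisanWigderson_eq_one (he : e ≤ d) {H : Finset (Fin d)}
    {a : Fin d → K} {b : Finset (Fin d × K)} {p : Polynomial.degreeLT K e}
    (hp : p ∈ polysThrough ι e H a) (hb : Disjoint b (graphOver ι Hᶜ (p : Polynomial K))) :
    (shiftedDeriv (indExp (graphOn H a)) (indExp b) (nisanWigderson F K d e ι)).coeff
      (indExp (b ∪ graphOver ι Hᶜ (p : Polynomial K))) = 1 := by
  obtain ⟨h1, h2⟩ := graphOver_univ_eq ι ((mem_polysThrough ι).1 hp)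
  rw [coeff_shiftedDeriv, if_pos (indExp_le_iff.2 Finset.subset_union_left),
    indExp_sub Finset.subset_union_left, Finset.union_sdiff_cancel_left hb,
    coeff_monomialDeriv_indExp _ _ h2.symm, ← indExp_union h2, ← h1,
    coeff_nisanWigderson_graphOver ι he]

-- Every multilinear monomial of a row, in particular its leading one, comes from a polynomial. This
-- gives the hypothesis on `lead` in `sq_card_nonzeroRows_le`.
open Classical in
theorem exists_of_coeff_shiftedDeriv_nisanWigderson_ne_zero {H : Finset (Fin d)}
    {a : Fin d → K} {b s : Finset (Fin d × K)}
    (h : (shiftedDeriv (indExp (graphOn H a)) (indExp b) (nisanWigderson F K d e ι)).coeff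
      (indExp s) ≠ 0) :
    ∃ p ∈ polysThrough ι e H a, Disjoint b (graphOver ι Hᶜ (p : Polynomial K)) ∧
      s = b ∪ graphOver ι Hᶜ (p : Polynomial K) := by
  rw [coeff_shiftedDeriv] at h
  split_ifs at h with hle
  · rw [indExp_le_iff] at hle
    rw [indExp_sub hle] at h
    obtain ⟨c, hc⟩ := coeff_monomialDeriv (indExp (graphOn H a)) (indExp (s \ b))
      (nisanWigderson F K d e ι)
    rw [hc] at h
    obtain ⟨p, hp⟩ := exists_of_coeff_nisanWigderson_ne_zero ι (right_ne_zero_of_mul h)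
    have hx : ∀ x, (if x ∈ graphOver ι Finset.univ (p : Polynomial K) then 1 else 0) =
        (if x ∈ s \ b then 1 else 0) + if x ∈ graphOn H a then 1 else 0 := by
      intro x
      have := DFunLike.congr_fun hp x
      rwa [Finsupp.add_apply, indExp_apply, indExp_apply, indExp_apply] at this
    have hpH : ∀ i ∈ H, (p : Polynomial K).eval (ι i) = a i := by
      intro i hi
      have h1 : (i, a i) ∈ graphOn H a := mem_graphOn.2 ⟨hi, rfl⟩
      have h2 := hx (i, a i)
      rw [if_pos h1] at h2
      by_cases h3 : (i, a i) ∈ graphOver ι Finset.univ (p : Polynomial K)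
      · exact ((mem_graphOver ι).1 h3).2.symm
      · rw [if_neg h3] at h2
        omega
    obtain ⟨h1, h2⟩ := graphOver_univ_eq ι hpH
    have h3 : s \ b = graphOver ι Hᶜ (p : Polynomial K) := by
      ext x
      have h4 := hx x
      rw [h1] at h4
      by_cases h5 : x ∈ graphOn H a
      · have h6 := Finset.disjoint_right.1 h2 h5
        rw [if_pos (Finset.mem_union_right _ h5), if_pos h5] at h4
        have : x ∉ s \ b := by
          intro h7
          rw [if_pos h7] at h4
          omega
        exact ⟨fun h => absurd h this, fun h => absurd h h6⟩
      · simp only [Finset.mem_union, h5, or_false, if_false, add_zero] at h4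
        by_cases h6 : x ∈ s \ b <;> by_cases h7 : x ∈ graphOver ι Hᶜ (p : Polynomial K) <;>
          simp_all
    refine ⟨p, (mem_polysThrough ι).2 hpH, ?_, ?_⟩
    · rw [← h3]
      exact Finset.disjoint_sdiff
    · rw [← h3, Finset.union_sdiff_of_subset hle]
  · exact absurd rfl h

end

/-! ### Counting nonzero rows and leading monomials -/

/-- The exponent satisfies `D (x - 1) / m ≤ 3/8 < 1/2`, and `exp (1/2) < 2`. -/
theorem one_add_div_pow_le_two {x m : ℝ} {D : ℕ} (hx1 : 1 ≤ x) (hx : x ≤ 4) (hm : 0 < m)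
    (hD : 8 * (D : ℝ) ≤ m) : (1 + (x - 1) / m) ^ D ≤ 2 := by
  have h0 : 0 ≤ (x - 1) / m := div_nonneg (by linarith) hm.le
  have h1 : 1 + (x - 1) / m ≤ Real.exp ((x - 1) / m) := by
    linarith [Real.add_one_le_exp ((x - 1) / m)]
  have h2 : (D : ℝ) * ((x - 1) / m) ≤ 1 / 2 := by
    rw [← mul_div_assoc, div_le_iff₀ hm]
    have : (0 : ℝ) ≤ D := by positivity
    nlinarith
  calc (1 + (x - 1) / m) ^ D ≤ Real.exp ((x - 1) / m) ^ D :=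
        pow_le_pow_left₀ (by linarith) h1 D
    _ = Real.exp (D * ((x - 1) / m)) := by rw [← Real.exp_nat_mul]
    _ ≤ Real.exp (1 / 2) := Real.exp_le_exp.2 h2
    _ ≤ 2 := by
        have h3 : Real.exp (1 / 2) ^ 2 = Real.exp 1 := by
          rw [← Real.exp_nat_mul]
          norm_num
        have h4 := Real.exp_one_lt_d9
        nlinarith [Real.exp_pos (1 / 2 : ℝ)]

/-- Both sides of `h1` count `ℓ`-sets together with an ordered list of `D` further elements. The
bound relates `lam` to `m^k μ`. -/
theorem choose_add_mul_pow_le {n ℓ D : ℕ} (hD : 2 * D ^ 2 ≤ ℓ + D) :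
    n.choose (ℓ + D) * (ℓ + D) ^ D ≤ 2 * (n.choose ℓ * (n - ℓ) ^ D) := by
  have h1 : n.choose (ℓ + D) * (ℓ + D).descFactorial D =
      n.choose ℓ * (n - ℓ).descFactorial D := by
    have h2 := Nat.choose_mul (n := n) (k := ℓ + D) (s := ℓ) (by omega)
    rw [Nat.add_sub_cancel_left, Nat.choose_symm_add] at h2
    rw [Nat.descFactorial_eq_factorial_mul_choose, Nat.descFactorial_eq_factorial_mul_choose,
      mul_left_comm, h2]
    ring
  calc n.choose (ℓ + D) * (ℓ + D) ^ D
      ≤ n.choose (ℓ + D) * (2 * (ℓ + D).descFactorial D) :=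
        Nat.mul_le_mul_left _ (pow_le_two_mul_descFactorial hD)
    _ = 2 * (n.choose ℓ * (n - ℓ).descFactorial D) := by rw [← h1]; ring
    _ ≤ _ := by gcongr; exact Nat.descFactorial_le_pow _ _

open Finset in
theorem card_filter_powersetCard_compl {σ : Type*} [Fintype σ] [DecidableEq σ] {ℓ : ℕ}
    (hℓ : ℓ ≤ Fintype.card σ) (P : Finset σ → Prop) [DecidablePred P]
    [DecidablePred fun b : Finset σ => P bᶜ] :
    #{b ∈ powersetCard ℓ (univ : Finset σ) | P bᶜ} =
      #{N ∈ powersetCard (Fintype.card σ - ℓ) (univ : Finset σ) | P N} := by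
  refine card_nbij' compl compl ?_ ?_ ?_ ?_
  · intro b hb
    simp only [coe_filter, mem_powersetCard, Set.mem_ofPred_eq, subset_univ, true_and] at hb ⊢
    exact ⟨by rw [card_compl, hb.1], hb.2⟩
  · intro b hb
    simp only [coe_filter, mem_powersetCard, Set.mem_ofPred_eq, subset_univ, true_and] at hb ⊢
    refine ⟨?_, by rw [compl_compl]; exact hb.2⟩
    rw [card_compl, hb.1]
    omega
  · exact fun b _ => compl_compl b
  · exact fun b _ => compl_compl b

section

variable {K : Type*} [Field K] [Fintype K] {d e ℓ : ℕ} (ι : Fin d ↪ K)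

open Finset Classical in
/-- The pairs of values on `H` and an `ℓ`-element set of variables for which some polynomial with
these values has the rest of its graph disjoint from the set. -/
noncomputable def nonzeroRows (e ℓ : ℕ) (H : Finset (Fin d)) :
    Finset ((Fin d → K) × Finset (Fin d × K)) :=
  {r ∈ valuesOn K H ×ˢ powersetCard ℓ univ |
    ∃ p ∈ polysThrough ι e H r.1, Disjoint r.2 (graphOver ι Hᶜ (p : Polynomial K))}

open Classical in
theorem sum_pow_card_graphOver_inter_le_two {s : ℕ} {H G : Finset (Fin d)} (hH : H.card ≤ e)
    (hG : Disjoint H G) (a : Fin d → K) (hs : s ≤ Fintype.card (Fin d × K)) (hs0 : 0 < s)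
    (hs4 : Fintype.card (Fin d × K) ≤ 4 * s) (hm : 8 * G.card ≤ Fintype.card K)
    {q : Polynomial.degreeLT K e} (hq : q ∈ polysThrough ι e H a) :
    ∑ r ∈ polysThrough ι e H a, ((Fintype.card (Fin d × K) : ℝ) / s) ^
        (graphOver ι G (q : Polynomial K) ∩ graphOver ι G (r : Polynomial K)).card ≤
      (polysThrough ι e H a).card * 2 + ((Fintype.card (Fin d × K) : ℝ) / s) ^ G.card := by
  have hs' : (0 : ℝ) < s := by exact_mod_cast hs0
  have hx1 : 1 ≤ (Fintype.card (Fin d × K) : ℝ) / s := by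
    rw [one_le_div hs']
    exact_mod_cast hs
  have hx4 : (Fintype.card (Fin d × K) : ℝ) / s ≤ 4 := by
    rw [div_le_iff₀ hs']
    exact_mod_cast hs4
  refine (sum_pow_card_graphOver_inter_le ι hH hG a hx1 hq).trans ?_
  gcongr
  exact one_add_div_pow_le_two hx1 hx4 (by exact_mod_cast Fintype.card_pos)
    (by exact_mod_cast hm)

/-- For fixed `a`, the row of `b` is nonzero exactly when the `(n - ℓ)`-set `bᶜ` contains a graph
over `Hᶜ` of a polynomial through `a`, so `le_card_superset_of_mem` applies. Summing over `a` gives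
the factor `m^|H|`. -/
theorem le_card_nonzeroRows {H : Finset (Fin d)} {μ : ℝ} (hH : H.card ≤ e)
    (hℓ : ℓ < Fintype.card (Fin d × K)) (hD : 2 * Hᶜ.card ^ 2 ≤ Fintype.card (Fin d × K) - ℓ)
    (hs4 : Fintype.card (Fin d × K) ≤ 4 * (Fintype.card (Fin d × K) - ℓ))
    (hm : 8 * Hᶜ.card ≤ Fintype.card K)
    (hμ : μ = (Fintype.card K : ℝ) ^ (e - H.card) *
      ((Fintype.card (Fin d × K) - ℓ : ℕ) / Fintype.card (Fin d × K) : ℝ) ^ Hᶜ.card) :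
    (Fintype.card K : ℝ) ^ H.card * ((Fintype.card (Fin d × K)).choose ℓ * μ) ≤
      4 * (2 * μ + 1) * (nonzeroRows ι e ℓ H).card := by
  classical
  set n := Fintype.card (Fin d × K)
  have hfib : ∀ a ∈ valuesOn K H, (n.choose ℓ * μ : ℝ) ≤ 4 * (2 * μ + 1) *
      ((nonzeroRows ι e ℓ H).filter fun r => r.1 = a).card := by
    intro a ha
    have hQ : (polysThrough ι e H a).card = Fintype.card K ^ (e - H.card) := by
      refine Nat.eq_of_mul_eq_mul_right (pow_pos (Fintype.card_pos (α := K)) H.card) ?_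
      rw [card_polysThrough_mul ι hH, ← pow_add, Nat.sub_add_cancel hH]
    have h1 := le_card_superset_of_mem (polysThrough ι e H a)
      (fun p => graphOver ι Hᶜ (p : Polynomial K)) (D := Hᶜ.card) (s := n - ℓ) (Nat.sub_le _ _)
      (by omega) hD (fun p _ => card_graphOver _ _ _)
      (fun q hq => sum_pow_card_graphOver_inter_le_two ι hH disjoint_compl_right a
        (Nat.sub_le _ _) (by omega) hs4 hm hq)
      (μ := μ) (by rw [hμ, hQ]; push_cast; rfl)
    rw [Nat.choose_symm hℓ.le] at h1
    refine h1.trans (le_of_eq ?_)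
    congr 2
    rw [← card_filter_powersetCard_compl hℓ.le (fun N : Finset (Fin d × K) =>
      ∃ q ∈ polysThrough ι e H a, graphOver ι Hᶜ (q : Polynomial K) ⊆ N)]
    refine Finset.card_nbij' (fun b => (a, b)) Prod.snd ?_ ?_ ?_ ?_
    · intro b hb
      simp only [Finset.coe_filter, Set.mem_ofPred_eq] at hb
      simp only [nonzeroRows, Finset.coe_filter, Set.mem_ofPred_eq, Finset.mem_filter,
        Finset.mem_product, and_true]
      obtain ⟨hb1, q, hq, hqb⟩ := hb
      exact ⟨⟨ha, hb1⟩, q, hq, (le_compl_iff_disjoint_left.1 hqb)⟩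
    · intro r hr
      simp only [nonzeroRows, Finset.coe_filter, Set.mem_ofPred_eq, Finset.mem_filter,
        Finset.mem_product] at hr
      simp only [Finset.coe_filter, Set.mem_ofPred_eq]
      obtain ⟨⟨⟨-, hr1⟩, q, hq, hqb⟩, rfl⟩ := hr
      exact ⟨hr1, q, hq, le_compl_iff_disjoint_left.2 hqb⟩
    · exact fun _ _ => rfl
    · intro r hr
      simp only [Finset.coe_filter, Set.mem_ofPred_eq] at hr
      exact Prod.ext hr.2.symm rfl
  have h2 := Finset.sum_le_sum hfib
  rw [Finset.sum_const, card_valuesOn, nsmul_eq_mul, ← Finset.mul_sum] at h2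
  rw [Finset.card_eq_sum_card_fiberwise (s := nonzeroRows ι e ℓ H) (f := Prod.fst)
    (t := valuesOn K H)]
  · push_cast at h2 ⊢
    exact h2
  · intro r hr
    simp only [nonzeroRows, Finset.coe_filter, Set.mem_ofPred_eq, Finset.mem_product] at hr
    exact hr.1.1

open Classical in
/-- If every nonzero row is mapped to one of the positions of its nonzero entries, then
the image of this map is large. -/
theorem sq_card_nonzeroRows_le {H : Finset (Fin d)} {lam : ℝ}
    (lead : (Fin d → K) × Finset (Fin d × K) → Finset (Fin d × K))
    (hlead : ∀ r ∈ nonzeroRows ι e ℓ H, ∃ p ∈ polysThrough ι e H r.1,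
      Disjoint r.2 (graphOver ι Hᶜ (p : Polynomial K)) ∧
        lead r = r.2 ∪ graphOver ι Hᶜ (p : Polynomial K))
    (ht : ℓ + Hᶜ.card ≤ Fintype.card (Fin d × K)) (ht0 : 0 < ℓ + Hᶜ.card)
    (hs4 : Fintype.card (Fin d × K) ≤ 4 * (ℓ + Hᶜ.card))
    (hm : 8 * Hᶜ.card ≤ Fintype.card K)
    (hlam : lam = (Fintype.card K : ℝ) ^ e *
      ((ℓ + Hᶜ.card : ℕ) / Fintype.card (Fin d × K) : ℝ) ^ Hᶜ.card) :
    ((nonzeroRows ι e ℓ H).card : ℝ) ^ 2 ≤ ((nonzeroRows ι e ℓ H).image lead).card *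
      ((Fintype.card (Fin d × K)).choose (ℓ + Hᶜ.card) * (lam ^ 2 * 2 + lam)) := by
  classical
  set R := nonzeroRows ι e ℓ H
  set n := Fintype.card (Fin d × K)
  set J := polysThrough ι e (∅ : Finset (Fin d)) 0
  have hJ : ∀ p, p ∈ J := fun p => (mem_polysThrough ι).2 (by simp)
  have hJc : (J.card : ℝ) = (Fintype.card K : ℝ) ^ e := by
    have := card_polysThrough_mul ι (e := e) (H := ∅) (by simp) 0
    simp only [Finset.card_empty, pow_zero, mul_one] at this
    exact_mod_cast this
  -- A row is recovered from `S` and its polynomial: `a` is the restriction to `H`, and `b` is `S`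
  -- without the graph.
  have hfib : ∀ S, (R.filter fun r => lead r = S).card ≤
      (J.filter fun p : Polynomial.degreeLT K e =>
        graphOver ι Hᶜ (p : Polynomial K) ⊆ S).card := by
    intro S
    choose! q hq1 hq2 hq3 using hlead
    refine Finset.card_le_card_of_injOn q ?_ ?_
    · intro r hr
      simp only [Finset.coe_filter, Set.mem_ofPred_eq] at hr ⊢
      refine ⟨hJ _, ?_⟩
      rw [← hr.2, hq3 r hr.1]
      exact Finset.subset_union_right
    · intro r hr r' hr' hrr
      simp only [Finset.coe_filter, Set.mem_ofPred_eq] at hr hr'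
      have h1 := hq1 r hr.1
      have h1' := hq1 r' hr'.1
      have hv : ∀ {r}, r ∈ R → r.1 ∈ valuesOn K H := by
        intro r hr
        simp only [R, nonzeroRows, Finset.mem_filter, Finset.mem_product] at hr
        exact hr.1.1
      rw [mem_polysThrough] at h1 h1'
      refine Prod.ext (eq_of_mem_valuesOn (hv hr.1) (hv hr'.1) fun i hi => ?_) ?_
      · rw [← h1 i hi, ← h1' i hi, hrr]
      · have h2 := hq3 r hr.1
        have h2' := hq3 r' hr'.1
        rw [hr.2] at h2
        rw [hr'.2] at h2'
        have h3 : r.2 = S \ graphOver ι Hᶜ (q r : Polynomial K) := by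
          rw [h2, Finset.union_sdiff_cancel_right (hq2 r hr.1)]
        have h3' : r'.2 = S \ graphOver ι Hᶜ (q r' : Polynomial K) := by
          rw [h2', Finset.union_sdiff_cancel_right (hq2 r' hr'.1)]
        rw [h3, h3', hrr]
  have hsub : R.image lead ⊆ Finset.powersetCard (ℓ + Hᶜ.card) Finset.univ := by
    intro S hS
    obtain ⟨r, hr, rfl⟩ := Finset.mem_image.1 hS
    obtain ⟨p, -, hd, he⟩ := hlead r hr
    simp only [R, nonzeroRows, Finset.mem_filter, Finset.mem_product,
      Finset.mem_powersetCard] at hr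
    rw [Finset.mem_powersetCard, he, Finset.card_union_of_disjoint hd, card_graphOver, hr.1.2.2]
    exact ⟨Finset.subset_univ _, rfl⟩
  have h1 : (R.card : ℝ) ≤ ∑ S ∈ R.image lead,
      ((J.filter fun p : Polynomial.degreeLT K e =>
        graphOver ι Hᶜ (p : Polynomial K) ⊆ S).card : ℝ) := by
    rw [Finset.card_eq_sum_card_image lead R]
    push_cast
    exact Finset.sum_le_sum fun S _ => by exact_mod_cast hfib S
  have h2 := sum_sq_card_subset_le J
    (fun p : Polynomial.degreeLT K e => graphOver ι Hᶜ (p : Polynomial K))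
    (D := Hᶜ.card) (κ := 2) ht ht0 (fun p _ => card_graphOver _ _ _)
    (fun q hq => sum_pow_card_graphOver_inter_le_two ι (by simp) (Finset.disjoint_empty_left _) 0
      ht ht0 hs4 hm hq)
  rw [hJc, ← hlam] at h2
  calc (R.card : ℝ) ^ 2 ≤ (∑ S ∈ R.image lead,
      ((J.filter fun p : Polynomial.degreeLT K e =>
        graphOver ι Hᶜ (p : Polynomial K) ⊆ S).card : ℝ)) ^ 2 := by gcongr
    _ ≤ (R.image lead).card * ∑ S ∈ R.image lead,
      ((J.filter fun p : Polynomial.degreeLT K e =>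
        graphOver ι Hᶜ (p : Polynomial K) ⊆ S).card : ℝ) ^ 2 :=
        sq_sum_le_card_mul_sum_sq
    _ ≤ (R.image lead).card * ∑ S ∈ Finset.powersetCard (ℓ + Hᶜ.card) Finset.univ,
      ((J.filter fun p : Polynomial.degreeLT K e =>
        graphOver ι Hᶜ (p : Polynomial K) ⊆ S).card : ℝ) ^ 2 := by gcongr
    _ ≤ _ := by gcongr

-- By `choose_add_mul_pow_le`, the lower bound for the number `R` of nonzero rows reads `choose n t
-- * lam ≤ 8 (2μ+1) R`. Squaring it and inserting the upper bound for `R²` leaves the number of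
-- leading monomials.
open Classical in
theorem le_card_image_lead {H : Finset (Fin d)} {μ lam : ℝ}
    (lead : (Fin d → K) × Finset (Fin d × K) → Finset (Fin d × K))
    (hlead : ∀ r ∈ nonzeroRows ι e ℓ H, ∃ p ∈ polysThrough ι e H r.1,
      Disjoint r.2 (graphOver ι Hᶜ (p : Polynomial K)) ∧
        lead r = r.2 ∪ graphOver ι Hᶜ (p : Polynomial K))
    (hH : H.card ≤ e) (ht : ℓ + Hᶜ.card ≤ Fintype.card (Fin d × K)) (ht0 : 0 < Hᶜ.card)
    (hD : 2 * Hᶜ.card ^ 2 ≤ Fintype.card (Fin d × K) - ℓ) (hD' : 2 * Hᶜ.card ^ 2 ≤ ℓ + Hᶜ.card)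
    (hs4 : Fintype.card (Fin d × K) ≤ 4 * (Fintype.card (Fin d × K) - ℓ))
    (ht4 : Fintype.card (Fin d × K) ≤ 4 * (ℓ + Hᶜ.card))
    (hm : 8 * Hᶜ.card ≤ Fintype.card K)
    (hμ : μ = (Fintype.card K : ℝ) ^ (e - H.card) *
      ((Fintype.card (Fin d × K) - ℓ : ℕ) / Fintype.card (Fin d × K) : ℝ) ^ Hᶜ.card)
    (hlam : lam = (Fintype.card K : ℝ) ^ e *
      ((ℓ + Hᶜ.card : ℕ) / Fintype.card (Fin d × K) : ℝ) ^ Hᶜ.card) :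
    (Fintype.card (Fin d × K)).choose (ℓ + Hᶜ.card) * lam ≤
      64 * (2 * μ + 1) ^ 2 * (2 * lam + 1) * ((nonzeroRows ι e ℓ H).image lead).card := by
  have h1 := le_card_nonzeroRows ι hH (by omega) hD hs4 hm hμ
  have h2 := sq_card_nonzeroRows_le ι lead hlead ht (by omega) ht4 hm hlam
  have h3 := choose_add_mul_pow_le (n := Fintype.card (Fin d × K)) hD'
  set n := Fintype.card (Fin d × K)
  set D := Hᶜ.card
  set L := ((((nonzeroRows ι e ℓ H).image lead).card : ℕ) : ℝ)
  set R := (((nonzeroRows ι e ℓ H).card : ℕ) : ℝ)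
  have hn : (0 : ℝ) < n := by exact_mod_cast (show 0 < n by omega)
  have hm0 : (0 : ℝ) < Fintype.card K := by exact_mod_cast Fintype.card_pos
  have hlam0 : 0 < lam := by
    rw [hlam]
    have : (0 : ℝ) < (ℓ + D : ℕ) := by exact_mod_cast (show 0 < ℓ + D by omega)
    positivity
  have hμ0 : 0 ≤ μ := by rw [hμ]; positivity
  have hC : (0 : ℝ) < n.choose (ℓ + D) := by exact_mod_cast Nat.choose_pos ht
  have h4 : (n.choose (ℓ + D) * lam : ℝ) ≤ 8 * (2 * μ + 1) * R := by
    have h5 : (n.choose (ℓ + D) : ℝ) * lam ≤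
        2 * ((Fintype.card K : ℝ) ^ H.card * (n.choose ℓ * μ)) := by
      have h6 : (n.choose (ℓ + D) : ℝ) * ((ℓ + D : ℕ) : ℝ) ^ D ≤
          2 * (n.choose ℓ * ((n - ℓ : ℕ) : ℝ) ^ D) := by exact_mod_cast h3
      have h7 : (Fintype.card K : ℝ) ^ e =
          (Fintype.card K : ℝ) ^ H.card * (Fintype.card K : ℝ) ^ (e - H.card) := by
        rw [← pow_add, Nat.add_sub_cancel' hH]
      rw [hlam, hμ, h7, div_pow, div_pow]
      calc _ = ((Fintype.card K : ℝ) ^ H.card * (Fintype.card K : ℝ) ^ (e - H.card) /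
            (n : ℝ) ^ D) * ((n.choose (ℓ + D) : ℝ) * ((ℓ + D : ℕ) : ℝ) ^ D) := by ring
        _ ≤ ((Fintype.card K : ℝ) ^ H.card * (Fintype.card K : ℝ) ^ (e - H.card) /
            (n : ℝ) ^ D) * (2 * (n.choose ℓ * ((n - ℓ : ℕ) : ℝ) ^ D)) := by gcongr
        _ = _ := by ring
    linarith
  have h8 : (n.choose (ℓ + D) * lam) ^ 2 ≤
      64 * (2 * μ + 1) ^ 2 * (L * (n.choose (ℓ + D) * (lam ^ 2 * 2 + lam))) := by
    calc (n.choose (ℓ + D) * lam) ^ 2 ≤ (8 * (2 * μ + 1) * R) ^ 2 := by gcongr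
      _ = 64 * (2 * μ + 1) ^ 2 * R ^ 2 := by ring
      _ ≤ _ := by gcongr
  refine le_of_mul_le_mul_left ?_ (mul_pos hC hlam0)
  linarith

end

/-! ### From leading monomials to the dimension and the rank -/

section

variable {σ F : Type*} [Fintype σ] [Field F]

theorem card_le_projShiftedDim {k ℓ : ℕ} (P : MvPolynomial σ F) {ord : Finset σ → ℕ}
    (hord : Function.Injective ord) (L : Finset (Finset σ))
    (hL : ∀ s ∈ L, ∃ α β : σ →₀ ℕ, α.degree = k ∧ β.degree = ℓ ∧
      (shiftedDeriv α β P).coeff (indExp s) ≠ 0 ∧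
        ∀ s', ord s < ord s' → (shiftedDeriv α β P).coeff (indExp s') = 0) :
    L.card ≤ projShiftedDim k ℓ P := by
  classical
  set G := {g : MvPolynomial σ F | ∃ α β : σ →₀ ℕ,
    α.degree = k ∧ β.degree = ℓ ∧ g = multPart (shiftedDeriv α β P)} with hG
  have hfin : G.Finite := by
    refine (((Finsupp.finite_of_degree_eq (σ := σ) k).prod
      (Finsupp.finite_of_degree_eq (σ := σ) ℓ)).image
        fun r => multPart (shiftedDeriv r.1 r.2 P)).subset ?_
    rintro g ⟨α, β, hα, hβ, rfl⟩
    exact ⟨(α, β), ⟨hα, hβ⟩, rfl⟩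
  have : FiniteDimensional F (Submodule.span F G) := FiniteDimensional.span_of_finite F hfin
  refine card_pivots_le_finrank (LinearMap.pi fun s => MvPolynomial.lcoeff F (indExp s))
    (Submodule.span F G) hord L fun s hs => ?_
  obtain ⟨α, β, hα, hβ, h0, h1⟩ := hL s hs
  refine ⟨_, Submodule.subset_span ⟨α, β, hα, hβ, rfl⟩, ?_, fun s' hs' => ?_⟩
  · simpa [coeff_multPart] using h0
  · simpa [coeff_multPart] using h1 s' hs'

/-- The shifted derivatives are homogeneous of degree `t`, so in the columns of degree `t`
multilinearization changes nothing, whatever the translation `c`. -/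
theorem card_le_rank_projShiftedMatrix {d k ℓ t : ℕ} (c : σ → F) {P : MvPolynomial σ F}
    (hP : ∀ v, P.coeff v ≠ 0 → v.degree = d) (ht : t + k = ℓ + d) {ord : Finset σ → ℕ}
    (hord : Function.Injective ord) (L : Finset (Finset σ))
    (hL : ∀ s ∈ L, s.card = t ∧ ∃ (α : σ →₀ ℕ) (b : Finset σ), α.degree = k ∧ b.card = ℓ ∧
      (shiftedDeriv α (indExp b) P).coeff (indExp s) ≠ 0 ∧
        ∀ s', ord s < ord s' → (shiftedDeriv α (indExp b) P).coeff (indExp s') = 0) :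
    L.card ≤ (projShiftedMatrix c k ℓ t P).rank := by
  classical
  have hf1 : Finite {α : σ →₀ ℕ // α.degree = k} := (Finsupp.finite_of_degree_eq k).to_subtype
  have hf2 : Finite {β : σ →₀ ℕ // β.degree = ℓ ∧ ∀ i, β i ≤ 1} :=
    ((Finsupp.finite_of_degree_eq ℓ).subset fun _ h => h.1).to_subtype
  have hcoeff : ∀ r s, projShiftedMatrix c k ℓ t P r s =
      (shiftedDeriv r.1.1 r.2.1 P).coeff (indExp s.1) := by
    intro r s
    refine coeff_multilinearize c fun u hu => ?_
    have h1 := degree_of_mem_support_shiftedDeriv hP hu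
    rw [r.1.2, r.2.2.1] at h1
    have h2 : s.1.card = t := s.2
    change u.degree = s.1.card
    omega
  have hc : (L.subtype fun s => s.card = t).card = L.card := by
    rw [Finset.card_subtype, Finset.filter_true_of_mem fun s hs => (hL s hs).1]
  rw [← hc]
  refine card_pivots_le_rank _ (ord := fun s => ord s.1)
    (fun s s' h => Subtype.ext (hord h)) _ fun s hs => ?_
  obtain ⟨-, α, b, hα, hb, h0, h1⟩ := hL s.1 (Finset.mem_subtype.1 hs)
  refine ⟨(⟨α, hα⟩, ⟨indExp b, by rw [degree_indExp, hb], indExp_le_one b⟩), ?_, ?_⟩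
  · rw [hcoeff]
    exact h0
  · intro s' hs'
    rw [hcoeff]
    exact h1 s'.1 hs'

end

section

variable {F : Type*} [Field F] {K : Type*} [Field K] [Fintype K] {d e k ℓ : ℕ} (ι : Fin d ↪ K)

/-- Many multilinear monomials are leading monomials of shifted derivatives. -/
theorem exists_leading_sets {μ lam : ℝ} (hke : k ≤ e) (hed : e ≤ d) (hkd : k < d)
    (ht : ℓ + (d - k) ≤ Fintype.card (Fin d × K))
    (hD : 2 * (d - k) ^ 2 ≤ Fintype.card (Fin d × K) - ℓ) (hD' : 2 * (d - k) ^ 2 ≤ ℓ + (d - k))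
    (hs4 : Fintype.card (Fin d × K) ≤ 4 * (Fintype.card (Fin d × K) - ℓ))
    (ht4 : Fintype.card (Fin d × K) ≤ 4 * (ℓ + (d - k)))
    (hm : 8 * (d - k) ≤ Fintype.card K)
    (hμ : μ = (Fintype.card K : ℝ) ^ (e - k) *
      ((Fintype.card (Fin d × K) - ℓ : ℕ) / Fintype.card (Fin d × K) : ℝ) ^ (d - k))
    (hlam : lam = (Fintype.card K : ℝ) ^ e *
      ((ℓ + (d - k) : ℕ) / Fintype.card (Fin d × K) : ℝ) ^ (d - k))
    (ord : Finset (Fin d × K) → ℕ) :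
    ∃ L : Finset (Finset (Fin d × K)),
      (∀ s ∈ L, s.card = ℓ + (d - k) ∧ ∃ (α : Fin d × K →₀ ℕ) (b : Finset (Fin d × K)),
        α.degree = k ∧ b.card = ℓ ∧
        (shiftedDeriv α (indExp b) (nisanWigderson F K d e ι)).coeff (indExp s) ≠ 0 ∧
          ∀ s', ord s < ord s' →
            (shiftedDeriv α (indExp b) (nisanWigderson F K d e ι)).coeff (indExp s') = 0) ∧
      (Fintype.card (Fin d × K)).choose (ℓ + (d - k)) * lam ≤
        64 * (2 * μ + 1) ^ 2 * (2 * lam + 1) * L.card := by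
  classical
  set H : Finset (Fin d) := Finset.univ.filter fun i => (i : ℕ) < k with hHdef
  have hHk : H.card = k := by
    rw [hHdef, Fin.card_filter_val_lt]
    omega
  have hHc : Hᶜ.card = d - k := by
    rw [Finset.card_compl, hHk, Fintype.card_fin]
  have hlead : ∀ r : (Fin d → K) × Finset (Fin d × K), ∃ s, r ∈ nonzeroRows ι e ℓ H →
      (shiftedDeriv (indExp (graphOn H r.1)) (indExp r.2)
        (nisanWigderson F K d e ι)).coeff (indExp s) ≠ 0 ∧ ∀ s', ord s < ord s' →
      (shiftedDeriv (indExp (graphOn H r.1)) (indExp r.2)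
        (nisanWigderson F K d e ι)).coeff (indExp s') = 0 := by
    intro r
    by_cases hr : r ∈ nonzeroRows ι e ℓ H
    · have hr' := hr
      simp only [nonzeroRows, Finset.mem_filter] at hr'
      obtain ⟨-, p, hp, hd⟩ := hr'
      have h1 := coeff_shiftedDeriv_nisanWigderson_eq_one (F := F) ι hed hp hd
      -- The leading monomial is the `ord`-largest multilinear monomial of the row.
      obtain ⟨s, hs, hmax⟩ := Finset.exists_max_image
        (Finset.univ.filter fun s => (shiftedDeriv (indExp (graphOn H r.1)) (indExp r.2)
          (nisanWigderson F K d e ι)).coeff (indExp s) ≠ 0) ord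
        ⟨_, Finset.mem_filter.2 ⟨Finset.mem_univ _, by rw [h1]; exact one_ne_zero⟩⟩
      refine ⟨s, fun _ => ⟨(Finset.mem_filter.1 hs).2, fun s' hs' => ?_⟩⟩
      by_contra hne
      exact absurd (hmax s' (Finset.mem_filter.2 ⟨Finset.mem_univ _, hne⟩)) (not_le.2 hs')
    · exact ⟨∅, fun h => absurd h hr⟩
  choose lead hlead using hlead
  have hlead2 : ∀ r ∈ nonzeroRows ι e ℓ H, ∃ p ∈ polysThrough ι e H r.1,
      Disjoint r.2 (graphOver ι Hᶜ (p : Polynomial K)) ∧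
        lead r = r.2 ∪ graphOver ι Hᶜ (p : Polynomial K) := fun r hr =>
    exists_of_coeff_shiftedDeriv_nisanWigderson_ne_zero ι (hlead r hr).1
  refine ⟨(nonzeroRows ι e ℓ H).image lead, ?_, ?_⟩
  · intro s hs
    obtain ⟨r, hr, rfl⟩ := Finset.mem_image.1 hs
    have hr' := hr
    simp only [nonzeroRows, Finset.mem_filter, Finset.mem_product,
      Finset.mem_powersetCard] at hr'
    obtain ⟨p, -, hd, he⟩ := hlead2 r hr
    refine ⟨?_, indExp (graphOn H r.1), r.2, ?_, hr'.1.2.2, hlead r hr⟩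
    · rw [he, Finset.card_union_of_disjoint hd, card_graphOver, hr'.1.2.2, hHc]
    · rw [degree_indExp, card_graphOn, hHk]
  · have := le_card_image_lead ι (H := H) (μ := μ) (lam := lam) lead hlead2
    rw [hHk, hHc] at this
    exact this hke ht (by omega) hD hD' hs4 ht4 hm hμ hlam

/-- The rank bounds in terms of the expected numbers `μ` and `lam` of polynomials whose graph is
disjoint from a random set, respectively contained in one. -/
theorem le_projShiftedDim_and_le_rank {μ lam : ℝ} (hke : k ≤ e) (hed : e ≤ d) (hkd : k < d)
    (ht : ℓ + (d - k) ≤ Fintype.card (Fin d × K))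
    (hD : 2 * (d - k) ^ 2 ≤ Fintype.card (Fin d × K) - ℓ) (hD' : 2 * (d - k) ^ 2 ≤ ℓ + (d - k))
    (hs4 : Fintype.card (Fin d × K) ≤ 4 * (Fintype.card (Fin d × K) - ℓ))
    (ht4 : Fintype.card (Fin d × K) ≤ 4 * (ℓ + (d - k)))
    (hm : 8 * (d - k) ≤ Fintype.card K)
    (hμ : μ = (Fintype.card K : ℝ) ^ (e - k) *
      ((Fintype.card (Fin d × K) - ℓ : ℕ) / Fintype.card (Fin d × K) : ℝ) ^ (d - k))
    (hlam : lam = (Fintype.card K : ℝ) ^ e *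
      ((ℓ + (d - k) : ℕ) / Fintype.card (Fin d × K) : ℝ) ^ (d - k)) :
    (Fintype.card (Fin d × K)).choose (ℓ + d - k) * lam ≤
        64 * (2 * μ + 1) ^ 2 * (2 * lam + 1) *
          projShiftedDim k ℓ (nisanWigderson F K d e ι) ∧
      ∀ c : Fin d × K → F, (Fintype.card (Fin d × K)).choose (ℓ + d - k) * lam ≤
        64 * (2 * μ + 1) ^ 2 * (2 * lam + 1) *
          (projShiftedMatrix c k ℓ (ℓ + d - k) (nisanWigderson F K d e ι)).rank := by
  classical
  set ord : Finset (Fin d × K) → ℕ := fun s => Fintype.equivFin (Finset (Fin d × K)) s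
  have hord : Function.Injective ord := fun s s' h =>
    (Fintype.equivFin _).injective (Fin.ext h)
  obtain ⟨L, hL, hbound⟩ := exists_leading_sets (F := F) ι hke hed hkd ht hD hD' hs4 ht4 hm hμ
    hlam ord
  rw [Nat.add_sub_assoc hkd.le]
  have hlam0 : 0 ≤ lam := by rw [hlam]; positivity
  have key : ∀ N : ℕ, L.card ≤ N → (Fintype.card (Fin d × K)).choose (ℓ + (d - k)) * lam ≤
      64 * (2 * μ + 1) ^ 2 * (2 * lam + 1) * N := by
    intro N hN
    refine hbound.trans ?_
    gcongr
  refine ⟨key _ ?_, fun c => key _ ?_⟩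
  · refine card_le_projShiftedDim _ hord L fun s hs => ?_
    obtain ⟨-, α, b, hα, hb, h⟩ := hL s hs
    exact ⟨α, indExp b, hα, by rw [degree_indExp, hb], h⟩
  · exact card_le_rank_projShiftedMatrix (d := d) c
      (fun v hv => degree_of_coeff_nisanWigderson_ne_zero ι hv) (by omega) hord L hL

end

/-! ### Estimates for parameters in the zone -/

theorem exp_neg_two_mul_le_one_sub {x : ℝ} (h0 : 0 ≤ x) (h1 : x ≤ 1 / 2) :
    Real.exp (-(2 * x)) ≤ 1 - x := by
  rw [Real.exp_neg, inv_le_comm₀ (Real.exp_pos _) (by linarith)]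
  have h2 := Real.add_one_le_exp (2 * x)
  refine le_trans ?_ h2
  rw [inv_le_iff_one_le_mul₀ (by linarith)]
  nlinarith

/-- Conditions on `d` that hold for all large `d`. -/
structure LargeEnough (b c₁ c₂ c₄ A : ℝ) (d : ℕ) : Prop where
  sqrt_le : b * Real.sqrt d ≤ d / 2
  eps_le : c₄ * (Real.log d / Real.sqrt d) ≤ 1 / 2
  le_mul : 8 ≤ c₁ * d
  le_self : c₂ ≤ d
  one_le_log : 1 ≤ Real.log d
  log_lt : 3 * A * Real.log d < d / 2 * Real.log (4 / 3)

theorem eventually_largeEnough (b c₁ c₂ c₄ A : ℝ) (hc₁ : 0 < c₁) :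
    ∀ᶠ d : ℕ in Filter.atTop, LargeEnough b c₁ c₂ c₄ A d := by
  have hcast := tendsto_natCast_atTop_atTop (R := ℝ)
  have hsqrt : Filter.Tendsto (fun d : ℕ => Real.sqrt d) Filter.atTop Filter.atTop :=
    Real.tendsto_sqrt_atTop.comp hcast
  have hlog : Filter.Tendsto (fun d : ℕ => Real.log d) Filter.atTop Filter.atTop :=
    Real.tendsto_log_atTop.comp hcast
  have h1 : ∀ᶠ d : ℕ in Filter.atTop, b * Real.sqrt d ≤ d / 2 := by
    filter_upwards [hsqrt.eventually_ge_atTop (2 * b)] with d hd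
    have := Real.mul_self_sqrt (Nat.cast_nonneg (α := ℝ) d)
    nlinarith [Real.sqrt_nonneg (d : ℝ)]
  have h2 : ∀ᶠ d : ℕ in Filter.atTop, c₄ * (Real.log d / Real.sqrt d) ≤ 1 / 2 := by
    have ho := (isLittleO_log_rpow_atTop (r := 1 / 2) (by norm_num)).tendsto_div_nhds_zero
    have ht : Filter.Tendsto (fun d : ℕ => c₄ * (Real.log d / Real.sqrt d)) Filter.atTop
        (nhds (c₄ * 0)) := by
      refine Filter.Tendsto.const_mul c₄ ?_
      refine (ho.comp hcast).congr fun d => ?_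
      simp [Real.sqrt_eq_rpow]
    rw [mul_zero] at ht
    exact ht.eventually_le_const (by norm_num)
  have h6 : ∀ᶠ d : ℕ in Filter.atTop, 3 * A * Real.log d < d / 2 * Real.log (4 / 3) := by
    have ho := Real.isLittleO_log_id_atTop.tendsto_div_nhds_zero
    have hl : 0 < Real.log (4 / 3) := Real.log_pos (by norm_num)
    have ht : Filter.Tendsto (fun d : ℕ => 3 * A * (Real.log d / d)) Filter.atTop
        (nhds (3 * A * 0)) := by
      refine Filter.Tendsto.const_mul _ ?_
      exact (ho.comp hcast).congr fun d => by simp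
    rw [mul_zero] at ht
    filter_upwards [ht.eventually_lt_const (show (0 : ℝ) < Real.log (4 / 3) / 2 by positivity),
      hcast.eventually_gt_atTop 0] with d hd hd0
    rw [← mul_div_assoc, div_lt_iff₀ hd0] at hd
    linarith
  filter_upwards [h1, h2, (hcast.const_mul_atTop hc₁).eventually_ge_atTop 8,
    hcast.eventually_ge_atTop c₂, hlog.eventually_ge_atTop 1, h6] with d a1 a2 a3 a4 a5 a6
  exact ⟨a1, a2, a3, a4, a5, a6⟩

/-- What the constraints on the parameters give for large `d`. -/
structure ZoneBounds (A : ℝ) (d k m e : ℕ) (ε : ℝ) : Prop where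
  two_mul_le : 2 * k ≤ d
  one_le : 1 ≤ d
  le_card : 8 * d ≤ m
  eps_nonneg : 0 ≤ ε
  eps_le : ε ≤ 1 / 2
  rpow_le : (m : ℝ) ^ A ≤ Real.exp (3 * A * Real.log d)
  k_le_e : k ≤ e
  e_le_d : e ≤ d

theorem ParamsInZone.zoneBounds {b c₁ c₂ c₃ c₄ A : ℝ} (hc₃ : 0 < c₃) (hA : 0 < A)
    {d k m e : ℕ} {ε : ℝ} (hd : LargeEnough b c₁ c₂ c₄ A d) (hk : (k : ℝ) ≤ b * Real.sqrt d)
    (h : ParamsInZone c₁ c₂ c₃ c₄ A d k m e ε) : ZoneBounds A d k m e ε := by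
  have hd1 : 1 ≤ d := by
    rcases Nat.eq_zero_or_pos d with h0 | h0
    · have := hd.le_mul
      rw [h0] at this
      norm_num at this
    · exact h0
  have hd1' : (1 : ℝ) ≤ d := by exact_mod_cast hd1
  have hL := hd.one_le_log
  have h2k : 2 * k ≤ d := by
    have : (2 * k : ℝ) ≤ d := by linarith [hd.sqrt_le]
    exact_mod_cast this
  have h8 : 8 * d ≤ m := by
    have : (8 * d : ℝ) ≤ m := le_trans (by nlinarith [hd.le_mul]) h.m_lower
    exact_mod_cast this
  have hm1 : (8 : ℝ) ≤ m := by exact_mod_cast (show 8 ≤ m by omega)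
  have hε0 : 0 ≤ ε := le_trans (by positivity) h.eps_lower
  have hε : ε ≤ 1 / 2 := h.eps_upper.trans hd.eps_le
  have hmA : (m : ℝ) ^ A ≤ Real.exp (3 * A * Real.log d) := by
    have h1 : (m : ℝ) ≤ (d : ℝ) ^ 3 := by
      refine h.m_upper.trans ?_
      have := mul_le_mul_of_nonneg_right hd.le_self (sq_nonneg (d : ℝ))
      linarith [pow_succ (d : ℝ) 2]
    rw [Real.rpow_def_of_pos (by linarith), Real.exp_le_exp]
    have h2 : Real.log m ≤ 3 * Real.log d := by
      have := Real.log_le_log (by linarith) h1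
      rwa [Real.log_pow] at this
    nlinarith
  have hD : (d : ℝ) / 2 ≤ ((d - k : ℕ) : ℝ) := by
    rw [Nat.cast_sub (by omega)]
    have : (2 * k : ℝ) ≤ d := by exact_mod_cast h2k
    linarith
  have hlt : (m : ℝ) ^ A < (4 / 3 : ℝ) ^ (d - k) := by
    refine hmA.trans_lt ?_
    have h1 : (4 / 3 : ℝ) ^ (d - k) = Real.exp ((d - k : ℕ) * Real.log (4 / 3)) := by
      rw [Real.exp_nat_mul, Real.exp_log (by norm_num)]
    rw [h1, Real.exp_lt_exp]
    refine hd.log_lt.trans_le ?_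
    have hl : 0 < Real.log (4 / 3) := Real.log_pos (by norm_num)
    gcongr
  have hcast : ((d : ℤ) - k) = ((d - k : ℕ) : ℤ) := by
    rw [Nat.cast_sub (by omega)]
  have hlow := h.pow_e_lower
  have hup := h.pow_e_upper
  rw [hcast, zpow_natCast] at hlow hup
  have hmA0 : (0 : ℝ) < (m : ℝ) ^ A := Real.rpow_pos_of_pos (by linarith) A
  have hβ1 : (4 / 3 : ℝ) ≤ 2 / (1 + ε) := by
    rw [le_div_iff₀ (by linarith)]
    linarith
  have hβ2 : 2 / (1 + ε) ≤ 2 := by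
    rw [div_le_iff₀ (by linarith)]
    linarith
  refine ⟨h2k, hd1, h8, hε0, hε, hmA, ?_, ?_⟩
  -- If `e < k`, then `m^(e-k) ≤ 1`, although its lower bound is at least `(4/3)^(d-k) m^(-A) > 1`.
  · by_contra hlt'
    have h1 : (m : ℝ) ^ ((e : ℤ) - k) ≤ 1 :=
      zpow_le_one_of_nonpos₀ (by linarith) (by omega)
    have h2 := hlow.trans h1
    rw [Real.rpow_neg (by linarith), ← div_eq_mul_inv, div_le_one hmA0] at h2
    have h3 : (4 / 3 : ℝ) ^ (d - k) ≤ (2 / (1 + ε)) ^ (d - k) := by gcongr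
    linarith
  -- If `e > d`, then `4^(d-k) ≤ m^(d-k) ≤ 2^(d-k) m^A`, so `2^(d-k) ≤ m^A`, against `hlt`.
  · by_contra hlt'
    have h1 : (m : ℝ) ^ (d - k) ≤ (m : ℝ) ^ ((e : ℤ) - k) := by
      rw [← zpow_natCast]
      exact zpow_le_zpow_right₀ (by linarith) (by omega)
    have h2 : (2 / (1 + ε)) ^ (d - k) ≤ (2 : ℝ) ^ (d - k) := by gcongr
    have h3 : (2 : ℝ) ^ (d - k) * (2 : ℝ) ^ (d - k) ≤ (m : ℝ) ^ (d - k) := by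
      rw [← mul_pow]
      gcongr
      linarith
    have h4 : (4 / 3 : ℝ) ^ (d - k) ≤ (2 : ℝ) ^ (d - k) := by
      gcongr
      norm_num
    have h5 : (0 : ℝ) < (2 : ℝ) ^ (d - k) := by positivity
    have h6 : (2 : ℝ) ^ (d - k) * (2 : ℝ) ^ (d - k) ≤ (2 : ℝ) ^ (d - k) * (m : ℝ) ^ A :=
      h3.trans (h1.trans (hup.trans (mul_le_mul_of_nonneg_right h2 hmA0.le)))
    have h7 := le_of_mul_le_mul_left h6 h5
    linarith

/-- Since `Y` is below both 1 and `lam`, `Y (2 lam + 1) ≤ 3 lam`; this covers small and large `lam`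
at once. The constant is `64 · 7² · 3`. -/
theorem mul_div_le_of_mul_le {C μ lam N X Y : ℝ} (hC : 0 ≤ C) (hN : 0 ≤ N) (hX : 1 ≤ X)
    (hμ0 : 0 ≤ μ) (hμ : μ ≤ 3 * X) (hY1 : Y ≤ 1) (hlam0 : 0 < lam) (hlam : Y ≤ lam)
    (h : C * lam ≤ 64 * (2 * μ + 1) ^ 2 * (2 * lam + 1) * N) :
    C * Y ≤ 9408 * X ^ 2 * N := by
  have h1 : (2 * μ + 1) ^ 2 ≤ (7 * X) ^ 2 := by
    have : 2 * μ + 1 ≤ 7 * X := by linarith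
    gcongr
  have h2 : Y * (2 * lam + 1) ≤ 3 * lam := by nlinarith
  have h3 : C * lam * (Y * (2 * lam + 1)) ≤ C * lam * (3 * lam) := by gcongr
  have h4 : C * lam * (3 * lam) ≤ 64 * (7 * X) ^ 2 * (2 * lam + 1) * N * (3 * lam) := by
    refine mul_le_mul_of_nonneg_right (h.trans ?_) (by positivity)
    gcongr
  have h5 : (C * Y) * (lam * (2 * lam + 1)) ≤ (9408 * X ^ 2 * N) * (lam * (2 * lam + 1)) := by
    calc _ = C * lam * (Y * (2 * lam + 1)) := by ring
      _ ≤ _ := h3.trans h4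
      _ = _ := by ring
  exact le_of_mul_le_mul_right h5 (by positivity)

/-- In the exponent, `9A` collects `3A` from the bound on `lam` and `6A` from the square of the
bound on `μ`; `11` absorbs the constant 9408. Linear terms in `L` are at most quadratic ones, as `L
≥ 1`. -/
theorem mul_exp_le_of_mul_le {C μ lam N A c L : ℝ} (hC : 0 ≤ C) (hN : 0 ≤ N) (hA : 0 < A)
    (hL : 1 ≤ L) (hμ0 : 0 ≤ μ) (hμ : μ ≤ 3 * Real.exp (3 * A * L)) (hlam0 : 0 < lam)
    (hlam : Real.exp (-(3 * A * L)) * Real.exp (-(2 * (c ^ 2 * L ^ 2))) ≤ lam)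
    (h : C * lam ≤ 64 * (2 * μ + 1) ^ 2 * (2 * lam + 1) * N) :
    C * Real.exp (-((9 * A + 2 * c ^ 2 + 11) * L ^ 2)) ≤ N := by
  have hL2 : L ≤ L ^ 2 := by nlinarith
  have h1 := mul_div_le_of_mul_le hC hN (Real.one_le_exp (x := 3 * A * L) (by positivity)) hμ0 hμ
    (by
      rw [← Real.exp_add, Real.exp_le_one_iff]
      have : 0 ≤ 3 * A * L := by positivity
      have : 0 ≤ 2 * (c ^ 2 * L ^ 2) := by positivity
      linarith) hlam0 hlam h
  have h9 : (9408 : ℝ) ≤ Real.exp 11 := by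
    have h2 : (2.7 : ℝ) ≤ Real.exp 1 := by linarith [Real.exp_one_gt_d9]
    calc (9408 : ℝ) ≤ 2.7 ^ 11 := by norm_num
      _ ≤ Real.exp 1 ^ 11 := by gcongr
      _ = Real.exp 11 := by rw [← Real.exp_nat_mul]; norm_num
  have hexp : Real.exp (-((9 * A + 2 * c ^ 2 + 11) * L ^ 2)) * (Real.exp 11 *
      Real.exp (3 * A * L) ^ 2) ≤
      Real.exp (-(3 * A * L)) * Real.exp (-(2 * (c ^ 2 * L ^ 2))) := by
    rw [← Real.exp_nat_mul, ← Real.exp_add, ← Real.exp_add, ← Real.exp_add, Real.exp_le_exp]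
    push_cast
    have : A * L ≤ A * L ^ 2 := by gcongr
    nlinarith
  have hP : 0 < Real.exp 11 * Real.exp (3 * A * L) ^ 2 := by positivity
  refine le_of_mul_le_mul_right ?_ hP
  calc C * Real.exp (-((9 * A + 2 * c ^ 2 + 11) * L ^ 2)) *
        (Real.exp 11 * Real.exp (3 * A * L) ^ 2)
      = C * (Real.exp (-((9 * A + 2 * c ^ 2 + 11) * L ^ 2)) * (Real.exp 11 *
        Real.exp (3 * A * L) ^ 2)) := by ring
    _ ≤ C * (Real.exp (-(3 * A * L)) * Real.exp (-(2 * (c ^ 2 * L ^ 2)))) := by gcongr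
    _ ≤ 9408 * Real.exp (3 * A * L) ^ 2 * N := h1
    _ ≤ Real.exp 11 * Real.exp (3 * A * L) ^ 2 * N := by gcongr
    _ = _ := by ring

/-- The expected number of disjoint graphs is at most `3 m^A`. -/
theorem mul_pow_le_three_mul {M X ε n ρ : ℝ} {D : ℕ} (hε0 : 0 ≤ ε)
    (hM : M ≤ (2 / (1 + ε)) ^ D * X) (hX : 0 ≤ X) (hn : 0 < n) (hD : 2 * (D : ℝ) ≤ n)
    (hρ0 : 0 ≤ ρ) (hρ : ρ ≤ (1 + ε) / 2 + 1 / n) : M * ρ ^ D ≤ 3 * X := by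
  -- The rounding error `1/n` in `ρ` costs `exp (2/n)` per factor, hence at most `e < 3` over `D ≤
  -- n/2` factors.
  have h1 : 2 / (1 + ε) * ρ ≤ Real.exp (2 / n) := by
    have h2 : 2 / (1 + ε) * ρ ≤ 2 / n + 1 := by
      calc 2 / (1 + ε) * ρ ≤ 2 / (1 + ε) * ((1 + ε) / 2 + 1 / n) := by gcongr
        _ = 1 + 2 / n / (1 + ε) := by
            have : (1 + ε) ≠ 0 := by positivity
            field_simp
        _ ≤ 1 + 2 / n := by
            have := div_le_self (a := 2 / n) (b := 1 + ε) (by positivity) (by linarith)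
            linarith
        _ = _ := by ring
    exact h2.trans (Real.add_one_le_exp _)
  calc M * ρ ^ D ≤ (2 / (1 + ε)) ^ D * X * ρ ^ D := by gcongr
    _ = X * (2 / (1 + ε) * ρ) ^ D := by ring
    _ ≤ X * Real.exp (2 / n) ^ D := by gcongr
    _ = X * Real.exp (D * (2 / n)) := by rw [← Real.exp_nat_mul]
    _ ≤ X * Real.exp 1 := by
        gcongr
        rw [← mul_div_assoc, div_le_one hn]
        linarith
    _ ≤ X * 3 := by
        gcongr
        linarith [Real.exp_one_lt_d9]
    _ = _ := by ring

/-- The expected number of contained graphs is not too small. -/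
theorem exp_mul_exp_le_mul_pow {M M' X ε ρ c L : ℝ} {d D : ℕ} (hε0 : 0 ≤ ε) (hε : ε ≤ 1 / 2)
    (hM : (1 + ε) ^ (2 * D) ≤ M) (hM' : (2 / (1 + ε)) ^ D * X⁻¹ ≤ M') (hX : 0 < X)
    (hρ : (1 - ε) / 2 ≤ ρ) (hDd : D ≤ d) (hd : 0 < d)
    (hεL : ε ≤ c * (L / Real.sqrt d)) :
    X⁻¹ * Real.exp (-(2 * (c ^ 2 * L ^ 2))) ≤ M * M' * ρ ^ D := by
  have hd' : (0 : ℝ) < d := by exact_mod_cast hd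
  -- Per factor, `(1+ε)² · 2/(1+ε) · (1-ε)/2 = 1 - ε²`.
  have h1 : X⁻¹ * (1 - ε ^ 2) ^ D ≤ M * M' * ρ ^ D := by
    have h2 : X⁻¹ * (1 - ε ^ 2) ^ D =
        (1 + ε) ^ (2 * D) * ((2 / (1 + ε)) ^ D * X⁻¹) * ((1 - ε) / 2) ^ D := by
      have h3 : 1 - ε ^ 2 = (1 + ε) ^ 2 * (2 / (1 + ε)) * ((1 - ε) / 2) := by
        have : (1 + ε) ≠ 0 := by positivity
        field_simp
        ring
      rw [h3, mul_pow, mul_pow, pow_mul]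
      ring
    rw [h2]
    have h4 : 0 ≤ (1 - ε) / 2 := by linarith
    have h5 : 0 ≤ M := le_trans (by positivity) hM
    have h6 : 0 ≤ M' := le_trans (by positivity) hM'
    have h7 : 0 ≤ M * M' := mul_nonneg h5 h6
    gcongr
  refine le_trans ?_ h1
  gcongr
  have h2 := exp_neg_two_mul_le_one_sub (x := ε ^ 2) (by positivity) (by nlinarith)
  have h3 : D * ε ^ 2 ≤ c ^ 2 * L ^ 2 := by
    have h4 : ε ^ 2 ≤ c ^ 2 * L ^ 2 / d := by
      have := pow_le_pow_left₀ hε0 hεL 2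
      rwa [mul_pow, div_pow, Real.sq_sqrt hd'.le, ← mul_div_assoc] at this
    calc D * ε ^ 2 ≤ d * (c ^ 2 * L ^ 2 / d) := by
          have : (D : ℝ) ≤ d := by exact_mod_cast hDd
          gcongr
      _ = _ := by field_simp
  calc Real.exp (-(2 * (c ^ 2 * L ^ 2))) ≤ Real.exp (D * (-(2 * ε ^ 2))) := by
        rw [Real.exp_le_exp]
        linarith
    _ = Real.exp (-(2 * ε ^ 2)) ^ D := by rw [← Real.exp_nat_mul]
    _ ≤ _ := by gcongr

theorem rank_bounds_of_paramsInZone {b c₁ c₂ c₃ c₄ A : ℝ} (hc₃ : 0 < c₃)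
    (hA : 0 < A) {d k m e ℓ : ℕ} {ε : ℝ} (hd : LargeEnough b c₁ c₂ c₄ A d)
    (hk : (k : ℝ) ≤ b * Real.sqrt d) (h : ParamsInZone c₁ c₂ c₃ c₄ A d k m e ε)
    (hℓ : |(ℓ : ℝ) - ((m : ℝ) * d) / 2 * (1 - ε)| < 1)
    {K : Type*} [Field K] [Fintype K] (ι : Fin d ↪ K) (hK : Fintype.card K = m)
    {F : Type*} [Field F] :
    ((m * d).choose (ℓ + d - k) : ℝ) *
        Real.exp (-((9 * A + 2 * c₄ ^ 2 + 11) * Real.log d ^ 2)) ≤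
      projShiftedDim k ℓ (nisanWigderson F K d e ι) ∧
    ∀ c : Fin d × K → F,
      ((m * d).choose (ℓ + d - k) : ℝ) *
          Real.exp (-((9 * A + 2 * c₄ ^ 2 + 11) * Real.log d ^ 2)) ≤
        (projShiftedMatrix c k ℓ (ℓ + d - k) (nisanWigderson F K d e ι)).rank := by
  have hz := h.zoneBounds hc₃ hA hd hk
  obtain ⟨h2k, hd1, h8, hε0, hε, hmA, hke, hed⟩ := hz
  have hcard : Fintype.card (Fin d × K) = m * d := by
    rw [Fintype.card_prod, Fintype.card_fin, hK, mul_comm]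
  have hnd : 8 * d ^ 2 ≤ m * d := by nlinarith
  have hn8 : 8 ≤ m * d := by nlinarith
  rw [abs_lt] at hℓ
  obtain ⟨hℓ1, hℓ2⟩ := hℓ
  have hn : (m : ℝ) * d = ((m * d : ℕ) : ℝ) := by push_cast; rfl
  rw [hn] at hℓ1 hℓ2
  generalize hnn : m * d = n at *
  have hn8' : (8 : ℝ) ≤ n := by exact_mod_cast hn8
  have hDpos : 1 ≤ d - k := by omega
  have hDd : (d - k) ^ 2 ≤ d ^ 2 := Nat.pow_le_pow_left (Nat.sub_le _ _) 2
  have hdd : d ≤ d ^ 2 := Nat.le_self_pow two_ne_zero d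
  -- From `0 ≤ ε ≤ 1/2`, `ℓ` lies between `n/4 - 1` and `n/2 + 1`; the 1 in the upper bound is at
  -- most `n/8`.
  have hℓu : 8 * ℓ ≤ 5 * n := by
    have : (8 * ℓ : ℝ) ≤ 5 * n := by nlinarith
    exact_mod_cast this
  have hℓl : n ≤ 4 * (ℓ + 1) := by
    have : (n : ℝ) ≤ 4 * (ℓ + 1) := by nlinarith
    exact_mod_cast this
  have hmpos : (0 : ℝ) < m := by exact_mod_cast (show 0 < m by omega)
  have hcast : ((d : ℤ) - k) = ((d - k : ℕ) : ℤ) := by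
    rw [Nat.cast_sub (by omega)]
  have hcast' : ((e : ℤ) - k) = ((e - k : ℕ) : ℤ) := by
    rw [Nat.cast_sub hke]
  have hcast2 : (2 * ((d : ℤ) - k)) = ((2 * (d - k) : ℕ) : ℤ) := by
    rw [hcast]
    push_cast
    rfl
  have hlow := h.pow_e_lower
  have hup := h.pow_e_upper
  have hpk := h.pow_k
  rw [hcast, hcast', zpow_natCast, zpow_natCast] at hlow hup
  rw [hcast2, zpow_natCast] at hpk
  rw [Real.rpow_neg hmpos.le] at hlow
  have hX0 : (0 : ℝ) < (m : ℝ) ^ A := Real.rpow_pos_of_pos hmpos A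
  have hmain := le_projShiftedDim_and_le_rank (F := F) (ℓ := ℓ) ι hke hed (by omega)
    (by rw [hcard]; omega) (by rw [hcard]; omega) (by omega) (by rw [hcard]; omega)
    (by rw [hcard]; omega) (by rw [hK]; omega) rfl rfl
  rw [hcard, hK] at hmain
  have hn0 : (0 : ℝ) < n := by linarith
  have hρ1 : ((n - ℓ : ℕ) / n : ℝ) ≤ (1 + ε) / 2 + 1 / n := by
    rw [Nat.cast_sub (by omega), div_le_iff₀ hn0, add_mul, one_div, inv_mul_cancel₀ hn0.ne']
    nlinarith
  -- Here `d - k ≥ 1` compensates the rounding of `ℓ`.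
  have hρ2 : (1 - ε) / 2 ≤ ((ℓ + (d - k) : ℕ) / n : ℝ) := by
    rw [le_div_iff₀ hn0]
    have : (1 : ℝ) ≤ ((d - k : ℕ) : ℝ) := by exact_mod_cast hDpos
    push_cast at this ⊢
    nlinarith
  have hμ := mul_pow_le_three_mul (D := d - k) hε0 hup hX0.le hn0
    (by exact_mod_cast (show 2 * (d - k) ≤ n by omega)) (by positivity) hρ1
  have hlam := exp_mul_exp_le_mul_pow (D := d - k) hε0 hε hpk hlow hX0 hρ2 (Nat.sub_le _ _) hd1
    h.eps_upper
  rw [← pow_add, Nat.add_sub_cancel' hke] at hlam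
  have hX : Real.exp (-(3 * A * Real.log d)) ≤ ((m : ℝ) ^ A)⁻¹ := by
    rw [Real.exp_neg]
    exact inv_anti₀ hX0 hmA
  have hlam' := (mul_le_mul_of_nonneg_right hX (Real.exp_pos _).le).trans hlam
  have key : ∀ N : ℕ, (n.choose (ℓ + d - k) : ℝ) * ((m : ℝ) ^ e *
        ((ℓ + (d - k) : ℕ) / n : ℝ) ^ (d - k)) ≤
      64 * (2 * ((m : ℝ) ^ (e - k) * ((n - ℓ : ℕ) / n : ℝ) ^ (d - k)) + 1) ^ 2 *
        (2 * ((m : ℝ) ^ e * ((ℓ + (d - k) : ℕ) / n : ℝ) ^ (d - k)) + 1) * N →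
      (n.choose (ℓ + d - k) : ℝ) *
        Real.exp (-((9 * A + 2 * c₄ ^ 2 + 11) * Real.log d ^ 2)) ≤ N := by
    intro N hN
    exact mul_exp_le_of_mul_le (by positivity) (by positivity) hA hd.one_le_log (by positivity)
      (hμ.trans (by gcongr)) (lt_of_lt_of_le (by positivity) hlam') hlam' hN
  exact ⟨key _ hmain.1, fun c => key _ (hmain.2 c)⟩

/-! ### Existence of parameters -/

/-- Parameters that satisfy the constraints exist, with `m` a power of two. -/
theorem exists_paramsInZone {a : ℝ} (ha : 0 < a) {d k : ℕ} (hd : 1 ≤ d) (hkd : k ≤ d)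
    (hk : a * Real.sqrt d ≤ k) :
    ∃ (m e : ℕ) (ε : ℝ), IsPrimePow m ∧ d ≤ m ∧ k ≤ e ∧ e ≤ m ∧ ε < 1 ∧
      ParamsInZone 1 2 (min a (1 / 2)) (min a (1 / 2)) 1 d k m e ε := by
  set c := min a (1 / 2) with hc
  have hc0 : 0 < c := lt_min ha (by norm_num)
  have hca : c ≤ a := min_le_left _ _
  have hc2 : c ≤ 1 / 2 := min_le_right _ _
  have hd' : (1 : ℝ) ≤ d := by exact_mod_cast hd
  have hlog0 : 0 ≤ Real.log d := Real.log_nonneg hd'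
  have hs1 : 1 ≤ Real.sqrt d := Real.one_le_sqrt.2 hd'
  have hss : Real.sqrt d * Real.sqrt d = d := Real.mul_self_sqrt (by linarith)
  -- The least power of two above `d²`.
  set m := 2 ^ (Nat.log 2 (d ^ 2) + 1) with hm
  have hdm : d ^ 2 < m := Nat.lt_pow_succ_log_self (by norm_num) _
  have hmd : m ≤ 2 * d ^ 2 := by
    rw [hm, pow_succ, mul_comm]
    exact Nat.mul_le_mul_left 2 (Nat.pow_log_le_self 2 (by positivity))
  have hdd : d ≤ d ^ 2 := Nat.le_self_pow two_ne_zero d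
  have hm2 : (2 : ℝ) ≤ m := by exact_mod_cast (show 2 ≤ m by omega)
  set ε := c * (Real.log d / Real.sqrt d) with hε
  have hε0 : 0 ≤ ε := by positivity
  have hε1 : ε < 1 := by
    have h1 : Real.log d ≤ 2 * (Real.sqrt d - 1) := by
      have h2 := Real.log_le_sub_one_of_pos (show 0 < Real.sqrt d by linarith)
      have h3 : Real.log d = 2 * Real.log (Real.sqrt d) := by
        rw [Real.log_sqrt (by linarith)]
        ring
      linarith
    have h4 : Real.log d / Real.sqrt d < 2 := by
      rw [div_lt_iff₀ (by linarith)]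
      linarith
    have h5 : 0 ≤ Real.log d / Real.sqrt d := by positivity
    nlinarith
  have hβ1 : 1 ≤ 2 / (1 + ε) := by
    rw [le_div_iff₀ (by linarith)]
    linarith
  have hβ2 : 2 / (1 + ε) ≤ 2 := div_le_self (by norm_num) (by linarith)
  -- With `e = k + f`, rounding down to a power of `m` loses less than one factor `m`, so `A = 1`
  -- suffices.
  obtain ⟨f, hf1, hf2⟩ := exists_nat_pow_near (one_le_pow₀ hβ1 : 1 ≤ (2 / (1 + ε)) ^ (d - k))
    (show (1 : ℝ) < m by linarith)
  have hfD : f ≤ d - k := by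
    rw [← pow_le_pow_iff_right₀ (show (1 : ℝ) < m by linarith)]
    refine hf1.trans ?_
    gcongr
    linarith
  have hcast : ((d : ℤ) - k) = ((d - k : ℕ) : ℤ) := by
    rw [Nat.cast_sub hkd]
  have hcast2 : (2 * ((d : ℤ) - k)) = ((2 * (d - k) : ℕ) : ℤ) := by
    rw [hcast]
    push_cast
    rfl
  have hcast' : (((k + f : ℕ) : ℤ) - k) = ((f : ℕ) : ℤ) := by
    push_cast
    ring
  refine ⟨m, k + f, ε, ?_, by omega, by omega, by omega, hε1, ?_, ?_, le_rfl, le_rfl, ?_, ?_, ?_⟩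
  · exact Nat.prime_two.isPrimePow.pow (Nat.succ_ne_zero _)
  · rw [one_mul]
    exact_mod_cast hdm.le
  · exact_mod_cast hmd
  · rw [hcast2, zpow_natCast]
    have h1 : 1 + ε ≤ Real.exp ε := by linarith [Real.add_one_le_exp ε]
    have h2 : 2 * Real.log d ≤ Real.log m := by
      have : ((d : ℝ) ^ 2) ≤ m := by exact_mod_cast hdm.le
      have := Real.log_le_log (by positivity) this
      rwa [Real.log_pow] at this
    -- Up to `1 + ε ≤ exp ε`, this is the logarithm of the constraint on `m^k`. It holds by the
    -- choice of `c`: `d ε = c √d log d`, `c √d ≤ k` and `2 log d ≤ log m`.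
    have h3 : ((2 * (d - k) : ℕ) : ℝ) * ε ≤ k * Real.log m := by
      have h4 : ((2 * (d - k) : ℕ) : ℝ) ≤ 2 * d := by
        exact_mod_cast (show 2 * (d - k) ≤ 2 * d by omega)
      calc ((2 * (d - k) : ℕ) : ℝ) * ε ≤ 2 * d * ε := by gcongr
        _ = 2 * (Real.sqrt d * Real.sqrt d) * ε := by rw [hss]
        _ = c * Real.sqrt d * (2 * Real.log d) := by
            rw [hε]
            field_simp
        _ ≤ k * Real.log m := by
            gcongr
            exact le_trans (by gcongr) hk
    calc (1 + ε) ^ (2 * (d - k)) ≤ Real.exp ε ^ (2 * (d - k)) := by gcongr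
      _ = Real.exp ((2 * (d - k) : ℕ) * ε) := by rw [← Real.exp_nat_mul]
      _ ≤ Real.exp (k * Real.log m) := Real.exp_le_exp.2 h3
      _ = (m : ℝ) ^ k := by rw [Real.exp_nat_mul, Real.exp_log (by linarith)]
  · rw [hcast, hcast', zpow_natCast, zpow_natCast, Real.rpow_neg_one,
      mul_inv_le_iff₀ (by linarith), ← pow_succ]
    exact hf2.le
  · rw [hcast, hcast', zpow_natCast, zpow_natCast, Real.rpow_one]
    exact hf1.trans (le_mul_of_one_le_right (by positivity) (by linarith))

theorem rank_projShiftedMatrix_le {σ F : Type*} [Fintype σ] [Field F] (c : σ → F) (k ℓ t : ℕ)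
    (P : MvPolynomial σ F) :
    (projShiftedMatrix c k ℓ t P).rank ≤ (shiftedMatrix c k ℓ t P).rank :=
  Matrix.rank_submatrix_le _ _ _

theorem mainTheorem4 :
    -- parameters satisfying the constraints exist
    (∀ a b : ℝ, 0 < a → 0 < b →
      ∃ c₁ c₂ c₃ c₄ A : ℝ, 0 < c₁ ∧ 0 < c₂ ∧ 0 < c₃ ∧ 0 < c₄ ∧ 0 < A ∧
        ∀ d k : ℕ, 1 ≤ d → k ≤ d → a * Real.sqrt d ≤ k → (k : ℝ) ≤ b * Real.sqrt d →
          ∃ (m e : ℕ) (ε : ℝ), IsPrimePow m ∧ d ≤ m ∧ k ≤ e ∧ e ≤ m ∧ ε < 1 ∧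
            ParamsInZone c₁ c₂ c₃ c₄ A d k m e ε) ∧
    -- the rank bound holds for all parameters satisfying the constraints
    (∀ b c₁ c₂ c₃ c₄ A : ℝ, 0 < b → 0 < c₁ → 0 < c₂ → 0 < c₃ → 0 < c₄ → 0 < A →
      ∃ (B : ℝ) (d₀ : ℕ), 0 < B ∧
        ∀ (d k m e ℓ : ℕ) (ε : ℝ), d₀ ≤ d → (k : ℝ) ≤ b * Real.sqrt d →
          ParamsInZone c₁ c₂ c₃ c₄ A d k m e ε →
          |(ℓ : ℝ) - ((m : ℝ) * d) / 2 * (1 - ε)| < 1 →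
          ∀ (K : Type*) [Field K] [Fintype K] (ι : Fin d ↪ K), Fintype.card K = m →
          ∀ (F : Type*) [Field F],
            ((m * d).choose (ℓ + d - k) : ℝ) * Real.exp (-(B * Real.log d ^ 2)) ≤
                projShiftedDim k ℓ (nisanWigderson F K d e ι) ∧
            ∀ c : Fin d × K → F,
              ((m * d).choose (ℓ + d - k) : ℝ) * Real.exp (-(B * Real.log d ^ 2)) ≤
                  (projShiftedMatrix c k ℓ (ℓ + d - k) (nisanWigderson F K d e ι)).rank ∧
              (projShiftedMatrix c k ℓ (ℓ + d - k) (nisanWigderson F K d e ι)).rank ≤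
                  (shiftedMatrix c k ℓ (ℓ + d - k) (nisanWigderson F K d e ι)).rank) := by

  refine ⟨fun a b ha _ => ⟨1, 2, min a (1 / 2), min a (1 / 2), 1, one_pos, two_pos,
    lt_min ha (by norm_num), lt_min ha (by norm_num), one_pos,
    fun d k hd hkd hk _ => exists_paramsInZone ha hd hkd hk⟩, ?_⟩
  intro b c₁ c₂ c₃ c₄ A _ hc₁ _ hc₃ _ hA
  obtain ⟨d₀, hd₀⟩ := Filter.eventually_atTop.1 (eventually_largeEnough b c₁ c₂ c₄ A hc₁)
  refine ⟨9 * A + 2 * c₄ ^ 2 + 11, d₀, by positivity, ?_⟩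
  intro d k m e ℓ ε hd hk hz hℓ K _ _ ι hK F _
  obtain ⟨h1, h2⟩ := rank_bounds_of_paramsInZone (F := F) hc₃ hA (hd₀ d hd) hk hz hℓ ι hK
  exact ⟨h1, fun c => ⟨h2 c, rank_projShiftedMatrix_le _ _ _ _ _⟩⟩
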